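/- Let $\Lambda:\mathbb R\to[-1,1]$ be the $1$-periodic hat function, i.e. $\Lambda$ is continuous, affine on $[0,\tfrac12]$ and on $[\tfrac12,1]$, with $\Lambda(0)=\Lambda(1)=-1$ and $\Lambda(\tfrac12)=1$. For $m:\mathbb R\to\mathbb R$ and $\Delta>0$ (e.g. $\Delta=1/N$ with $N\in\mathbb N$) put $$\mathcal S^\Delta(\bar u)=m(\bar u)+\Lambda(\bar u/\Delta).$$ For a family $p(\cdot\,|\,\bar u)$ of probability laws on $\mathbb R$, a noise level $\sigma>0$ and a function $D:\mathbb R\times[0,1]\to\mathbb R$ put $$\mathcal J_p(D,\sigma)=\mathbb E_{\bar u\sim\mathcal U([0,1])}\,\mathbb E_{u\sim p(\cdot|\bar u)}\,\mathbb E_{\eta\sim\mathcal N(0,\sigma^2)}\,|D(u+\eta;\bar u)-u|^2 .$$ For $\tilde\epsilon>0$ let $\nu^\Delta(\cdot\,|\,\bar u)$ be the law of $m(\bar u)+\Lambda\big((\bar u+\delta\bar u)/\Delta\big)$ with $\delta\bar u\sim\mathcal U([-\tilde\epsilon,\tilde\epsilon])$, let $\mu$ be the uniform probability measure on $\{(u,\bar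 u)\in\mathbb R\times[0,1]: m(\bar u)-1\le u\le m(\bar u)+1\}$, and let $\mu(\cdot\,|\,\bar u)=\mathcal U([m(\bar u)-1,m(\bar u)+1])$. For every $K\ge 0$ there is $L_0>0$, depending only on $K$, such that for all $L^*\ge L_0$, all $K$-Lipschitz $m:\mathbb R\to\mathbb R$ and all $\tilde\epsilon>0$ the following hold. 1. For all $\Delta,\sigma>0$ there is a minimizer $D^\Delta(\cdot\,;\cdot,\sigma)$ of $\mathcal J_p(\cdot,\sigma)$ with $p(\cdot\,|\,\bar u)=\delta_{\mathcal S^\Delta(\bar u)}$ over all functions on $\mathbb R\times[0,1]$ that are $L^*$-Lipschitz for the Euclidean distance, and there is a minimizer $\tilde D^\Delta(\cdot\,;\cdot,\sigma)$ of $\mathcal J_p(\cdot,\sigma)$ with $p=\nu^\Delta$ over all measurable functions. 2. For every choice of such minimizers, $$\lim_{\Delta\to0}\ \sup_{\sigma>0}\ \mathbb E_{(u,\bar u)\sim\mu}\,\mathbb E_{\eta\sim\mathcal N(0,\sigma^2)}\left|D^\Delta(u+\eta;\bar u,\sigma)-\tilde D^\Delta(u+\eta;\bar u,\sigma)\right|^2=0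 .$$ 3. $\nu^\Delta(\cdot\,|\,\bar u)\to\mu(\cdot\,|\,\bar u)$ as $\Delta\to0$, in the following sense: there is a constant $C>0$, independent of $\Delta$ and $\bar u$, such that for all $\Delta>0$ and all $\bar u\in[0,1]$, $$(1-C\Delta)\,\mu(\cdot\,|\,\bar u)\ \le\ \nu^\Delta(\cdot\,|\,\bar u)\ \le\ (1+C\Delta)\,\mu(\cdot\,|\,\bar u)\quad\text{as measures.}$$ -/

import Mathlib

open MeasureTheory ProbabilityTheory Filter Set
open scoped ENNReal NNReal Topology

noncomputable section

/-- The uniform probability measure on the interval `[a, b]` (for `a < b`). -/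
def uniformLaw (a b : ℝ) : Measure ℝ :=
  ProbabilityTheory.cond volume (Icc a b)

/-- The `1`-periodic hat function: it is piecewise linear, with value `-1` at the integers and
value `1` at the half-integers. -/
def hat (t : ℝ) : ℝ :=
  1 - |4 * Int.fract t - 2|

/-- The map `x ↦ m x + hat (x / Δ)`; with `Δ = 1 / N` this is `m x + hat (N x)`. -/
def toyMap (m : ℝ → ℝ) (Δ x : ℝ) : ℝ :=
  m x + hat (x / Δ)

/-- The deterministic conditional law: given the input `x`, the output is `toyMap m Δ x`. -/
def dataLaw (m : ℝ → ℝ) (Δ x : ℝ) : Measure ℝ :=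
  Measure.dirac (toyMap m Δ x)

/-- The smoothed conditional law: given `x`, the law of `m x + hat ((x + v) / Δ)` for `v` uniformly
distributed on `[-ε, ε]`. -/
def smoothedLaw (m : ℝ → ℝ) (ε Δ x : ℝ) : Measure ℝ :=
  (uniformLaw (-ε) ε).map fun v => m x + hat ((x + v) / Δ)

/-- The uniform probability measure on `{(u, x) : x ∈ [0, 1], u ∈ [m x - 1, m x + 1]}`. -/
def limitLaw (m : ℝ → ℝ) : Measure (ℝ × ℝ) :=
  ProbabilityTheory.cond volume {p : ℝ × ℝ | p.2 ∈ Icc 0 1 ∧ p.1 ∈ Icc (m p.2 - 1) (m p.2 + 1)}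

/-- The centred Gaussian law of standard deviation `σ`, that is, of variance `σ ^ 2`. -/
def noise (σ : ℝ) : Measure ℝ :=
  gaussianReal 0 (Real.toNNReal (σ ^ 2))

/-- The denoiser training objective at noise level `σ` for the conditional laws `p x` of `u`, where
the input `x` is uniformly distributed on `[0, 1]`. A denoiser at this noise level is a function
`D` of the noisy sample and of the input. -/
def denoisingLoss (p : ℝ → Measure ℝ) (σ : ℝ) (D : ℝ → ℝ → ℝ) : ℝ≥0∞ :=
  ∫⁻ x, ∫⁻ u, ∫⁻ η, ENNReal.ofReal ((D (u + η) x - u) ^ 2) ∂(noise σ) ∂(p x) ∂(uniformLaw 0 1)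

/-- `D` is `L`-Lipschitz on `ℝ × [0, 1]`, for the Euclidean distance. -/
def LipschitzDenoiser (L : ℝ) (D : ℝ → ℝ → ℝ) : Prop :=
  ∀ u u' : ℝ, ∀ x ∈ Icc (0 : ℝ) 1, ∀ x' ∈ Icc (0 : ℝ) 1,
    |D u x - D u' x'| ≤ L * √((u - u') ^ 2 + (x - x') ^ 2)

/-- `D` minimizes the training objective among all `L`-Lipschitz denoisers. -/
def IsOptimalLipschitzDenoiser (L : ℝ) (p : ℝ → Measure ℝ) (σ : ℝ) (D : ℝ → ℝ → ℝ) : Prop :=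
  LipschitzDenoiser L D ∧
    ∀ D' : ℝ → ℝ → ℝ, LipschitzDenoiser L D' → denoisingLoss p σ D ≤ denoisingLoss p σ D'

/-- `D` minimizes the training objective among all (measurable) denoisers. -/
def IsOptimalDenoiser (p : ℝ → Measure ℝ) (σ : ℝ) (D : ℝ → ℝ → ℝ) : Prop :=
  Measurable (Function.uncurry D) ∧
    ∀ D' : ℝ → ℝ → ℝ, Measurable (Function.uncurry D') →
      denoisingLoss p σ D ≤ denoisingLoss p σ D'

/-- The mean square distance of two denoisers, at noisy samples `u + η` with `(u, x)` distributed
according to `limitLaw m` and `η` a centred Gaussian of standard deviation `σ`. -/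
def denoiserSqDist (m : ℝ → ℝ) (σ : ℝ) (D₁ D₂ : ℝ → ℝ → ℝ) : ℝ≥0∞ :=
  ∫⁻ q, ∫⁻ η, ENNReal.ofReal ((D₁ (q.1 + η) q.2 - D₂ (q.1 + η) q.2) ^ 2) ∂(noise σ) ∂(limitLaw m)

end

theorem measurable_hat : Measurable hat := by
  unfold hat
  fun_prop

theorem hat_add_one (t : ℝ) : hat (t + 1) = hat t := by
  simp [hat]

theorem abs_hat_le (t : ℝ) : |hat t| ≤ 1 := by
  have h0 := Int.fract_nonneg t
  have h1 := (Int.fract_lt_one t).le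
  unfold hat
  rw [abs_le]
  constructor
  · have : |4 * Int.fract t - 2| ≤ 2 := abs_le.2 ⟨by linarith, by linarith⟩
    linarith
  · linarith [abs_nonneg (4 * Int.fract t - 2)]

theorem hat_of_mem_left {t : ℝ} (ht : t ∈ Icc (0 : ℝ) (1 / 2)) : hat t = 4 * t - 1 := by
  have hf : Int.fract t = t := Int.fract_eq_self.2 ⟨ht.1, by linarith [ht.2]⟩
  rw [hat, hf, abs_of_nonpos (by linarith [ht.2])]
  ring

theorem hat_of_mem_right {t : ℝ} (ht : t ∈ Ico (1 / 2 : ℝ) 1) : hat t = 3 - 4 * t := by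
  have hf : Int.fract t = t := Int.fract_eq_self.2 ⟨by linarith [ht.1], ht.2⟩
  rw [hat, hf, abs_of_nonneg (by linarith [ht.1])]
  ring

theorem uniformLaw_eq (a b : ℝ) :
    uniformLaw a b = (ENNReal.ofReal (b - a))⁻¹ • volume.restrict (Icc a b) := by
  rw [uniformLaw, ProbabilityTheory.cond, Real.volume_Icc]

theorem isProbabilityMeasure_uniformLaw {a b : ℝ} (h : a < b) :
    IsProbabilityMeasure (uniformLaw a b) := by
  refine cond_isProbabilityMeasure_of_finite ?_ ?_ <;> simp [h]

theorem lintegral_uniformLaw (a b : ℝ) (f : ℝ → ℝ≥0∞) :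
    ∫⁻ x, f x ∂(uniformLaw a b) = (ENNReal.ofReal (b - a))⁻¹ * ∫⁻ x in Icc a b, f x := by
  rw [uniformLaw_eq, lintegral_smul_measure, smul_eq_mul]

theorem uniformLaw_zero_one : uniformLaw 0 1 = volume.restrict (Icc 0 1) := by
  simp [uniformLaw_eq]

theorem setLIntegral_affine {a c : ℝ} (ha : a ≠ 0) {s : Set ℝ} (hs : MeasurableSet s)
    (f : ℝ → ℝ≥0∞) :
    ∫⁻ x in (fun t => a * t + c) '' s, f x = ENNReal.ofReal |a| * ∫⁻ t in s, f (a * t + c) := by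
  rw [lintegral_image_eq_lintegral_abs_deriv_mul (f' := fun _ => a) hs
    (fun x _ => ?_) (fun x _ y _ h => ?_) f]
  · rw [lintegral_const_mul' _ _ ENNReal.ofReal_ne_top]
  · simpa using (((hasDerivAt_id x).const_mul a).add_const c).hasDerivWithinAt
  · simpa [ha] using h

theorem image_affine_Icc {a : ℝ} (ha : 0 < a) (c x y : ℝ) :
    (fun t => a * t + c) '' Icc x y = Icc (a * x + c) (a * y + c) := by
  rw [← image_image (fun t => t + c) (fun t => a * t), Set.image_mul_left_Icc' ha,
    Set.image_add_const_Icc]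

/-- The hat function maps the uniform law on a period to the uniform law on `[-1, 1]`. -/
theorem setLIntegral_comp_hat (f : ℝ → ℝ≥0∞) :
    2 * ∫⁻ t in Icc (0 : ℝ) 1, f (hat t) = ∫⁻ w in Icc (-1 : ℝ) 1, f w := by
  have hu : Icc (0 : ℝ) 1 = Icc 0 (1 / 2) ∪ Ioc (1 / 2) 1 := by
    rw [Icc_union_Ioc_eq_Icc] <;> norm_num
  have hl : ∫⁻ w in Icc (-1 : ℝ) 1, f w = 4 * ∫⁻ t in Icc (0 : ℝ) (1 / 2), f (hat t) := by
    have h := setLIntegral_affine (a := 4) (c := -1) (by norm_num)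
      (measurableSet_Icc (a := (0 : ℝ)) (b := 1 / 2)) f
    rw [image_affine_Icc (by norm_num)] at h
    norm_num at h
    rw [h]
    congr 1
    refine setLIntegral_congr_fun measurableSet_Icc fun t ht => ?_
    simp only [hat_of_mem_left (t := t) (by simpa using ht), sub_eq_add_neg]
  have hr : ∫⁻ w in Icc (-1 : ℝ) 1, f w = 4 * ∫⁻ t in Ioc (1 / 2 : ℝ) 1, f (hat t) := by
    have h := setLIntegral_affine (a := -4) (c := 3) (by norm_num)
      (measurableSet_Icc (a := (1 / 2 : ℝ)) (b := 1)) f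
    have him : (fun t : ℝ => -4 * t + 3) '' Icc (1 / 2) 1 = Icc (-1) 1 := by
      ext w
      simp only [mem_image, mem_Icc]
      constructor
      · rintro ⟨t, ⟨h1, h2⟩, rfl⟩
        constructor <;> linarith
      · rintro ⟨h1, h2⟩
        exact ⟨(3 - w) / 4, ⟨by linarith, by linarith⟩, by ring⟩
    rw [him] at h
    norm_num at h
    rw [h]
    congr 1
    rw [setLIntegral_congr Ico_ae_eq_Icc.symm, ← setLIntegral_congr Ico_ae_eq_Ioc]
    refine setLIntegral_congr_fun measurableSet_Ico fun t ht => ?_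
    rw [hat_of_mem_right ht]
    congr 1
    ring
  rw [hu, lintegral_union measurableSet_Ioc]
  · set A := ∫⁻ t in Icc (0 : ℝ) (1 / 2), f (hat t)
    rw [mul_add]
    have h2 : (4 : ℝ≥0∞) = 2 * 2 := by norm_num
    rw [hl, h2, mul_assoc, mul_assoc] at hr
    have : 2 * A = 2 * ∫⁻ t in Ioc (1 / 2 : ℝ) 1, f (hat t) :=
      (ENNReal.mul_right_inj (by norm_num) (by norm_num)).1 hr
    rw [← this, hl, ← two_mul, ← mul_assoc]
    norm_num
  · rw [Set.disjoint_left]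
    intro t h1 h2
    exact absurd h1.2 (not_le.2 h2.1)

theorem lintegral_uniformLaw_centered (c : ℝ) (f : ℝ → ℝ≥0∞) :
    ∫⁻ u, f u ∂(uniformLaw (c - 1) (c + 1)) = ∫⁻ t, f (c + hat t) ∂(uniformLaw 0 1) := by
  rw [uniformLaw_zero_one, lintegral_uniformLaw]
  have h := setLIntegral_affine (a := 1) (c := c) one_ne_zero
    (measurableSet_Icc (a := (-1 : ℝ)) (b := 1)) f
  rw [image_affine_Icc one_pos] at h
  norm_num at h
  rw [show c - 1 = -1 + c by ring, add_comm c 1, h, ← setLIntegral_comp_hat (fun w => f (w + c)),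
    ← mul_assoc]
  have : ENNReal.ofReal (1 + c - (-1 + c)) = 2 := by
    ring_nf
    simp
  rw [this, ENNReal.inv_mul_cancel (by norm_num) (by norm_num), one_mul]
  simp only [add_comm]

theorem uniformLaw_centered (c : ℝ) :
    uniformLaw (c - 1) (c + 1) = (uniformLaw 0 1).map fun t => c + hat t := by
  ext s hs
  rw [← lintegral_indicator_one hs, lintegral_uniformLaw_centered, ← lintegral_indicator_one hs,
    lintegral_map (measurable_one.indicator hs) (measurable_hat.const_add c)]

theorem setLIntegral_Ioc_periodic {F : ℝ → ℝ≥0∞} (hF : Function.Periodic F 1) (a : ℝ) :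
    ∫⁻ t in Ioc a (a + 1), F t = ∫⁻ t in Ioc (0 : ℝ) 1, F t := by
  have h0 := isAddFundamentalDomain_Ioc (one_pos (α := ℝ)) 0 volume
  have ha := isAddFundamentalDomain_Ioc (one_pos (α := ℝ)) a volume
  rw [zero_add] at h0
  refine ha.setLIntegral_eq h0 F fun g x => ?_
  obtain ⟨n, hn⟩ := AddSubgroup.mem_zmultiples_iff.1 g.2
  rw [AddSubgroup.vadd_def, ← hn, vadd_eq_add, add_comm]
  exact hF.zsmul n x

theorem setLIntegral_Ioc_periodic_nat {F : ℝ → ℝ≥0∞} (hF : Function.Periodic F 1) (a : ℝ)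
    (n : ℕ) : ∫⁻ t in Ioc a (a + n), F t = n * ∫⁻ t in Ioc (0 : ℝ) 1, F t := by
  induction n with
  | zero => simp
  | succ n ih =>
    have hn : (0 : ℝ) ≤ n := n.cast_nonneg
    rw [← Ioc_union_Ioc_eq_Ioc (b := a + n) (by linarith) (by push_cast; linarith),
      lintegral_union measurableSet_Ioc, ih]
    · push_cast
      rw [← add_assoc a, setLIntegral_Ioc_periodic hF, add_mul, one_mul]
    · rw [Set.disjoint_left]
      intro t h1 h2
      exact absurd h1.2 (not_le.2 h2.1)

theorem lintegral_smoothed {ε Δ : ℝ} (hε : 0 < ε) (hΔ : 0 < Δ) (x : ℝ) (F : ℝ → ℝ≥0∞) :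
    ∫⁻ v, F ((x + v) / Δ) ∂(uniformLaw (-ε) ε) = (ENNReal.ofReal (2 * ε / Δ))⁻¹ *
      ∫⁻ t in Ioc ((x - ε) / Δ) ((x - ε) / Δ + 2 * ε / Δ), F t := by
  have h := setLIntegral_affine (a := 1 / Δ) (c := x / Δ) (by positivity)
    (measurableSet_Icc (a := -ε) (b := ε)) F
  rw [image_affine_Icc (by positivity), abs_of_pos (by positivity)] at h
  have e1 : 1 / Δ * -ε + x / Δ = (x - ε) / Δ := by ring
  have e2 : 1 / Δ * ε + x / Δ = (x - ε) / Δ + 2 * ε / Δ := by ring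
  have e3 : ∀ v, 1 / Δ * v + x / Δ = (x + v) / Δ := fun v => by ring
  simp only [e1, e2, e3] at h
  rw [setLIntegral_congr Ioc_ae_eq_Icc, h, lintegral_uniformLaw, ← mul_assoc]
  congr 1
  rw [← ENNReal.ofReal_inv_of_pos (by linarith), ← ENNReal.ofReal_inv_of_pos (by positivity),
    ← ENNReal.ofReal_mul (by positivity)]
  congr 1
  field_simp
  ring

/-- The smoothed law is within a factor `1 ± Δ / (2 ε)` of the uniform law. -/
theorem smoothedLaw_bounds (m : ℝ → ℝ) {ε Δ : ℝ} (hε : 0 < ε) (hΔ : 0 < Δ) (x : ℝ) :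
    ENNReal.ofReal (1 - 1 / (2 * ε) * Δ) • uniformLaw (m x - 1) (m x + 1) ≤ smoothedLaw m ε Δ x ∧
    smoothedLaw m ε Δ x ≤
      ENNReal.ofReal (1 + 1 / (2 * ε) * Δ) • uniformLaw (m x - 1) (m x + 1) := by
  set T := 2 * ε / Δ with hT
  have hTpos : 0 < T := by positivity
  have hTi : 1 / (2 * ε) * Δ = 1 / T := by rw [hT]; field_simp
  set n := ⌊T⌋₊
  have hn1 : (n : ℝ) ≤ T := Nat.floor_le hTpos.le
  have hn2 : T < n + 1 := Nat.lt_floor_add_one T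
  have key : ∀ s, MeasurableSet s → ∃ I J : ℝ≥0∞, uniformLaw (m x - 1) (m x + 1) s = I ∧
      smoothedLaw m ε Δ x s = (ENNReal.ofReal T)⁻¹ * J ∧ n * I ≤ J ∧ J ≤ (n + 1 : ℕ) * I := by
    intro s hs
    set F : ℝ → ℝ≥0∞ := fun t => s.indicator 1 (m x + hat t) with hF
    have hper : Function.Periodic F 1 := fun t => by simp [hF, hat_add_one]
    refine ⟨∫⁻ t in Ioc (0 : ℝ) 1, F t,
      ∫⁻ t in Ioc ((x - ε) / Δ) ((x - ε) / Δ + T), F t, ?_, ?_, ?_, ?_⟩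
    · rw [← lintegral_indicator_one hs, lintegral_uniformLaw_centered, uniformLaw_zero_one,
        setLIntegral_congr Ioc_ae_eq_Icc]
    · rw [← lintegral_smoothed hε hΔ, smoothedLaw, ← lintegral_indicator_one hs,
        lintegral_map (measurable_one.indicator hs)]
      exact (measurable_hat.comp (by fun_prop)).const_add _
    · rw [← setLIntegral_Ioc_periodic_nat hper ((x - ε) / Δ)]
      exact lintegral_mono_set (Ioc_subset_Ioc_right (by linarith))
    · rw [← setLIntegral_Ioc_periodic_nat hper ((x - ε) / Δ)]
      exact lintegral_mono_set (Ioc_subset_Ioc_right (by push_cast; linarith))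
  rw [hTi]
  constructor <;> refine Measure.le_iff.2 fun s hs => ?_ <;>
    obtain ⟨I, J, hI, hJ, h1, h2⟩ := key s hs <;>
    rw [Measure.smul_apply, hI, hJ, smul_eq_mul]
  · calc ENNReal.ofReal (1 - 1 / T) * I ≤ (ENNReal.ofReal T)⁻¹ * n * I := by
          gcongr
          rw [← ENNReal.ofReal_inv_of_pos hTpos, ← ENNReal.ofReal_natCast,
            ← ENNReal.ofReal_mul (by positivity)]
          apply ENNReal.ofReal_le_ofReal
          rw [inv_mul_eq_div, le_div_iff₀ hTpos]
          field_simp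
          linarith
      _ ≤ _ := by rw [mul_assoc]; gcongr
  · calc (ENNReal.ofReal T)⁻¹ * J ≤ (ENNReal.ofReal T)⁻¹ * (n + 1 : ℕ) * I := by
          rw [mul_assoc]; gcongr
      _ ≤ _ := by
          gcongr
          rw [← ENNReal.ofReal_inv_of_pos hTpos, ← ENNReal.ofReal_natCast,
            ← ENNReal.ofReal_mul (by positivity)]
          apply ENNReal.ofReal_le_ofReal
          rw [inv_mul_eq_div, div_le_iff₀ hTpos]
          push_cast
          field_simp
          linarith

/-- The mean of `g w`, with `w` distributed according to `l`, given the value `v` of `g w` plus a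
centred Gaussian of variance `s`. -/
noncomputable def posteriorMean (l : Measure ℝ) (g : ℝ → ℝ) (s : ℝ≥0) (v : ℝ) : ℝ :=
  (∫ w, g w * gaussianPDFReal (g w) s v ∂l) / ∫ w, gaussianPDFReal (g w) s v ∂l

theorem measurable_gaussianPDFReal_mean (s : ℝ≥0) :
    Measurable fun p : ℝ × ℝ => gaussianPDFReal p.1 s p.2 := by
  unfold gaussianPDFReal
  fun_prop

theorem measurable_gaussianPDF_mean (s : ℝ≥0) :
    Measurable fun p : ℝ × ℝ => gaussianPDF p.1 s p.2 :=
  (measurable_gaussianPDFReal_mean s).ennreal_ofReal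

theorem gaussianPDFReal_le (u : ℝ) (s : ℝ≥0) (v : ℝ) :
    gaussianPDFReal u s v ≤ (√(2 * Real.pi * s))⁻¹ := by
  rw [gaussianPDFReal]
  refine mul_le_of_le_one_right (by positivity) ?_
  rw [Real.exp_le_one_iff]
  exact div_nonpos_of_nonpos_of_nonneg (by nlinarith [sq_nonneg (v - u)]) (by positivity)

section

variable {l : Measure ℝ} [IsProbabilityMeasure l] {g : ℝ → ℝ} {R : ℝ}

theorem integrable_mul_gaussianPDFReal (hg : Measurable g) {h : ℝ → ℝ} (hh : Measurable h)
    {C : ℝ} (hC : ∀ w, |h w| ≤ C) (s : ℝ≥0) (v : ℝ) :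
    Integrable (fun w => h w * gaussianPDFReal (g w) s v) l := by
  refine Integrable.of_bound (C := C * (√(2 * Real.pi * s))⁻¹) ?_ (.of_forall fun w => ?_)
  · exact (hh.mul ((measurable_gaussianPDFReal_mean s).comp
      (hg.prodMk measurable_const))).aestronglyMeasurable
  · rw [norm_mul, Real.norm_eq_abs, Real.norm_of_nonneg (gaussianPDFReal_nonneg _ _ _)]
    exact mul_le_mul (hC w) (gaussianPDFReal_le _ _ _) (gaussianPDFReal_nonneg _ _ _)
      ((abs_nonneg _).trans (hC w))

theorem integrable_gaussianPDFReal_comp (hg : Measurable g) (s : ℝ≥0) (v : ℝ) :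
    Integrable (fun w => gaussianPDFReal (g w) s v) l := by
  simpa using integrable_mul_gaussianPDFReal (l := l) hg (measurable_const (a := (1 : ℝ)))
    (C := 1) (by simp) s v

theorem integral_gaussianPDFReal_comp_pos (hg : Measurable g) {s : ℝ≥0} (hs : s ≠ 0) (v : ℝ) :
    0 < ∫ w, gaussianPDFReal (g w) s v ∂l := by
  rw [integral_pos_iff_support_of_nonneg (fun w => gaussianPDFReal_nonneg _ _ _)
    (integrable_gaussianPDFReal_comp hg s v)]
  have : Function.support (fun w => gaussianPDFReal (g w) s v) = univ := by
    ext w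
    simpa using (gaussianPDFReal_pos (g w) s v hs).ne'
  simp [this]

theorem integral_sub_mul_gaussianPDFReal (hg : Measurable g) (hR : ∀ w, |g w| ≤ R) {s : ℝ≥0}
    (hs : s ≠ 0) (c v : ℝ) :
    ∫ w, (g w - c) * gaussianPDFReal (g w) s v ∂l =
      (posteriorMean l g s v - c) * ∫ w, gaussianPDFReal (g w) s v ∂l := by
  have hW := integral_gaussianPDFReal_comp_pos (l := l) hg hs v
  simp only [sub_mul]
  rw [integral_sub (integrable_mul_gaussianPDFReal hg hg hR s v)
    ((integrable_gaussianPDFReal_comp hg s v).const_mul _), integral_const_mul, posteriorMean,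
    div_mul_cancel₀ _ hW.ne']

theorem lintegral_sq_sub_eq_add (hg : Measurable g) (hR : ∀ w, |g w| ≤ R) {s : ℝ≥0}
    (hs : s ≠ 0) (a v : ℝ) :
    ∫⁻ w, ENNReal.ofReal ((a - g w) ^ 2) * gaussianPDF (g w) s v ∂l =
      (∫⁻ w, ENNReal.ofReal ((posteriorMean l g s v - g w) ^ 2) * gaussianPDF (g w) s v ∂l) +
      ∫⁻ w, ENNReal.ofReal ((a - posteriorMean l g s v) ^ 2) * gaussianPDF (g w) s v ∂l := by
  set d := posteriorMean l g s v with hd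
  have hint : ∀ c : ℝ, Integrable (fun w => (c - g w) ^ 2 * gaussianPDFReal (g w) s v) l := by
    intro c
    refine integrable_mul_gaussianPDFReal hg (by fun_prop) (C := (|c| + R) ^ 2) (fun w => ?_) s v
    rw [abs_pow]
    have := abs_sub c (g w)
    gcongr
    linarith [hR w]
  have hk := integrable_gaussianPDFReal_comp (l := l) hg s v
  have hlin : Integrable (fun w => (g w - d) * gaussianPDFReal (g w) s v) l := by
    simp only [sub_mul]
    exact (integrable_mul_gaussianPDFReal hg hg hR s v).sub (hk.const_mul d)
  have hnn : ∀ (c : ℝ) w, 0 ≤ (c - g w) ^ 2 * gaussianPDFReal (g w) s v :=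
    fun c w => mul_nonneg (sq_nonneg _) (gaussianPDFReal_nonneg _ _ _)
  have hconst : Integrable (fun w => (a - d) ^ 2 * gaussianPDFReal (g w) s v) l := hk.const_mul _
  simp only [gaussianPDF]
  simp_rw [← ENNReal.ofReal_mul (sq_nonneg _)]
  rw [← ofReal_integral_eq_lintegral_ofReal (hint a) (.of_forall (hnn a)),
    ← ofReal_integral_eq_lintegral_ofReal (hint d) (.of_forall (hnn d)),
    ← ofReal_integral_eq_lintegral_ofReal hconst
      (.of_forall fun w => mul_nonneg (sq_nonneg _) (gaussianPDFReal_nonneg _ _ _)),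
    ← ENNReal.ofReal_add (integral_nonneg (hnn d))
      (integral_nonneg fun w => mul_nonneg (sq_nonneg _) (gaussianPDFReal_nonneg _ _ _)),
    ← integral_add (hint d) hconst]
  congr 1
  have h0 : ∫ w, (-2 * (a - d)) * ((g w - d) * gaussianPDFReal (g w) s v) ∂l = 0 := by
    rw [integral_const_mul, integral_sub_mul_gaussianPDFReal hg hR hs, ← hd, sub_self, zero_mul,
      mul_zero]
  rw [← add_zero (∫ w, (d - g w) ^ 2 * gaussianPDFReal (g w) s v +
    (a - d) ^ 2 * gaussianPDFReal (g w) s v ∂l), ← h0,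
    ← integral_add (by exact (hint d).add hconst) (hlin.const_mul _)]
  refine integral_congr_ae (.of_forall fun w => ?_)
  ring

theorem lintegral_gaussianReal_zero_add (u : ℝ) {s : ℝ≥0} (hs : s ≠ 0) {f : ℝ → ℝ≥0∞}
    (hf : Measurable f) :
    ∫⁻ η, f (u + η) ∂(gaussianReal 0 s) = ∫⁻ v, f v * gaussianPDF u s v := by
  have h := gaussianReal_map_const_add (μ := 0) (v := s) u
  rw [zero_add] at h
  rw [← lintegral_map hf (measurable_const_add u), h, gaussianReal_of_var_ne_zero _ hs,
    lintegral_withDensity_eq_lintegral_mul _ (measurable_gaussianPDF _ _) hf]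
  simp [mul_comm]

theorem lintegral_lintegral_gaussianReal (hg : Measurable g) {s : ℝ≥0} (hs : s ≠ 0)
    {f : ℝ → ℝ → ℝ≥0∞} (hf : Measurable (Function.uncurry f)) :
    ∫⁻ w, ∫⁻ η, f (g w + η) w ∂(gaussianReal 0 s) ∂l =
      ∫⁻ v, ∫⁻ w, f v w * gaussianPDF (g w) s v ∂l := by
  have h : ∀ w, ∫⁻ η, f (g w + η) w ∂(gaussianReal 0 s) = ∫⁻ v, f v w * gaussianPDF (g w) s v :=
    fun w => lintegral_gaussianReal_zero_add (g w) hs (f := fun v => f v w)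
      (hf.comp (measurable_id.prodMk measurable_const))
  simp_rw [h]
  have hf' : Measurable fun p : ℝ × ℝ => f p.2 p.1 := hf.comp measurable_swap
  have hk : Measurable fun p : ℝ × ℝ => gaussianPDF (g p.1) s p.2 :=
    (measurable_gaussianPDF_mean s).comp (f := fun p : ℝ × ℝ => (g p.1, p.2)) (by fun_prop)
  have hm : Measurable fun p : ℝ × ℝ => f p.2 p.1 * gaussianPDF (g p.1) s p.2 := hf'.mul hk
  exact lintegral_lintegral_swap hm.aemeasurable

theorem measurable_posteriorMean_uncurry {g : ℝ → ℝ → ℝ} (hg : Measurable (Function.uncurry g))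
    (s : ℝ≥0) : Measurable fun p : ℝ × ℝ => posteriorMean l (g p.2) s p.1 := by
  have hG : Measurable fun q : (ℝ × ℝ) × ℝ => g q.1.2 q.2 :=
    hg.comp (g := Function.uncurry g) (f := fun q : (ℝ × ℝ) × ℝ => (q.1.2, q.2)) (by fun_prop)
  have hk : Measurable fun q : (ℝ × ℝ) × ℝ => gaussianPDFReal (g q.1.2 q.2) s q.1.1 := by
    unfold gaussianPDFReal
    fun_prop
  have h1 : Measurable fun p : ℝ × ℝ => ∫ w, g p.2 w * gaussianPDFReal (g p.2 w) s p.1 ∂l :=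
    ((hG.mul hk).stronglyMeasurable.integral_prod_right').measurable
  have h2 : Measurable fun p : ℝ × ℝ => ∫ w, gaussianPDFReal (g p.2 w) s p.1 ∂l :=
    (hk.stronglyMeasurable.integral_prod_right').measurable
  exact h1.div h2

theorem measurable_posteriorMean (hg : Measurable g) (s : ℝ≥0) :
    Measurable (posteriorMean l g s) :=
  (measurable_posteriorMean_uncurry (l := l) (g := fun _ => g) (hg.comp measurable_snd) s).comp
    (f := fun v => (v, (0 : ℝ))) (by fun_prop)

/-- The posterior mean is the optimal denoiser; the excess loss of any other denoiser is its mean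
square distance to the posterior mean. -/
theorem lintegral_denoising_eq_add (hg : Measurable g) (hR : ∀ w, |g w| ≤ R) {s : ℝ≥0}
    (hs : s ≠ 0) {D : ℝ → ℝ} (hD : Measurable D) :
    ∫⁻ w, ∫⁻ η, ENNReal.ofReal ((D (g w + η) - g w) ^ 2) ∂(gaussianReal 0 s) ∂l =
      (∫⁻ w, ∫⁻ η, ENNReal.ofReal ((posteriorMean l g s (g w + η) - g w) ^ 2)
        ∂(gaussianReal 0 s) ∂l) +
      ∫⁻ w, ∫⁻ η, ENNReal.ofReal ((D (g w + η) - posteriorMean l g s (g w + η)) ^ 2)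
        ∂(gaussianReal 0 s) ∂l := by
  have hp := measurable_posteriorMean (l := l) hg s
  rw [lintegral_lintegral_gaussianReal hg hs (f := fun v w => ENNReal.ofReal ((D v - g w) ^ 2))
      (by unfold Function.uncurry; fun_prop),
    lintegral_lintegral_gaussianReal hg hs
      (f := fun v w => ENNReal.ofReal ((posteriorMean l g s v - g w) ^ 2))
      (by unfold Function.uncurry; fun_prop),
    lintegral_lintegral_gaussianReal hg hs
      (f := fun v _ => ENNReal.ofReal ((D v - posteriorMean l g s v) ^ 2))
      (by unfold Function.uncurry; fun_prop), ← lintegral_add_left]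
  · exact lintegral_congr fun v => lintegral_sq_sub_eq_add hg hR hs (D v) v
  · refine Measurable.lintegral_prod_right' (f := fun q : ℝ × ℝ =>
      ENNReal.ofReal ((posteriorMean l g s q.1 - g q.2) ^ 2) * gaussianPDF (g q.2) s q.1) ?_
    exact Measurable.mul (by fun_prop) ((measurable_gaussianPDF_mean s).comp
      ((hg.comp measurable_snd).prodMk measurable_fst))

end

section

variable {l : Measure ℝ} [IsProbabilityMeasure l] {g : ℝ → ℝ} {R : ℝ}

theorem abs_posteriorMean_le (hg : Measurable g) (hR : ∀ w, |g w| ≤ R) {s : ℝ≥0}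
    (hs : s ≠ 0) (v : ℝ) : |posteriorMean l g s v| ≤ R := by
  have hW := integral_gaussianPDFReal_comp_pos (l := l) hg hs v
  rw [posteriorMean, abs_div, abs_of_pos hW, div_le_iff₀ hW, ← integral_const_mul]
  refine (abs_integral_le_integral_abs).trans (integral_mono
    (integrable_mul_gaussianPDFReal hg hg hR s v).abs
    ((integrable_gaussianPDFReal_comp hg s v).const_mul _) fun w => ?_)
  simp only [abs_mul, abs_of_nonneg (gaussianPDFReal_nonneg (g w) s v)]
  exact mul_le_mul_of_nonneg_right (hR w) (gaussianPDFReal_nonneg _ _ _)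

theorem posteriorMean_const_add (c : ℝ) (s : ℝ≥0) (hg : Measurable g) (hR : ∀ w, |g w| ≤ R)
    (hs : s ≠ 0) (v : ℝ) :
    posteriorMean l (fun w => c + g w) s v = c + posteriorMean l g s (v - c) := by
  have hk : ∀ w, gaussianPDFReal (c + g w) s v = gaussianPDFReal (g w) s (v - c) := fun w => by
    simp only [gaussianPDFReal]
    ring_nf
  have hW := integral_gaussianPDFReal_comp_pos (l := l) hg hs (v - c)
  simp only [posteriorMean, hk, add_mul]
  rw [integral_add ((integrable_gaussianPDFReal_comp hg s _).const_mul _)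
    (integrable_mul_gaussianPDFReal hg hg hR s _), integral_const_mul]
  field_simp

theorem monotone_posteriorMean (hg : Measurable g) (hR : ∀ w, |g w| ≤ R) {s : ℝ≥0}
    (hs : s ≠ 0) : Monotone (posteriorMean l g s) := by
  intro y z hyz
  set d := posteriorMean l g s y with hd
  have hW := integral_gaussianPDFReal_comp_pos (l := l) hg hs z
  have hs' : (0 : ℝ) < s := lt_of_le_of_ne s.2 fun h => hs (NNReal.coe_eq_zero.1 h.symm)
  set r : ℝ → ℝ := fun u => Real.exp ((z - y) * (2 * u - y - z) / (2 * s)) with hr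
  have hrmono : Monotone r := fun a b hab => by
    apply Real.exp_le_exp.2
    gcongr
  have hk : ∀ u, gaussianPDFReal u s z = r u * gaussianPDFReal u s y := fun u => by
    simp only [gaussianPDFReal, hr]
    rw [mul_left_comm, ← Real.exp_add]
    congr 2
    field_simp
    ring
  have hint : ∀ v, Integrable (fun w => (g w - d) * gaussianPDFReal (g w) s v) l := fun v =>
    integrable_mul_gaussianPDFReal hg (hg.sub_const d) (C := R + |d|)
      (fun w => (abs_sub _ _).trans (by linarith [hR w])) s v
  have h0 : 0 ≤ ∫ w, (g w - d) * gaussianPDFReal (g w) s z ∂l := by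
    calc (0 : ℝ) = ∫ w, r d * ((g w - d) * gaussianPDFReal (g w) s y) ∂l := by
          rw [integral_const_mul, integral_sub_mul_gaussianPDFReal hg hR hs, ← hd]
          ring
      _ ≤ _ := by
          refine integral_mono ((hint y).const_mul _) (hint z) fun w => ?_
          simp only [hk]
          have h1 : 0 ≤ (g w - d) * (r (g w) - r d) := by
            rcases le_total d (g w) with h | h
            · exact mul_nonneg (by linarith) (by linarith [hrmono h])
            · exact mul_nonneg_of_nonpos_of_nonpos (by linarith) (by linarith [hrmono h])
          have := mul_nonneg h1 (gaussianPDFReal_nonneg (g w) s y)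
          linarith
  rw [integral_sub_mul_gaussianPDFReal hg hR hs] at h0
  linarith [nonneg_of_mul_nonneg_left h0 hW]

end

instance isProbabilityMeasure_uniformLaw_zero_one : IsProbabilityMeasure (uniformLaw 0 1) :=
  isProbabilityMeasure_uniformLaw one_pos

/-- The mean of a positive density on an interval increases with the interval. -/
theorem truncated_mean_mono {f : ℝ → ℝ} (hf : Continuous f) (hpos : ∀ z, 0 < f z)
    {a b a' b' p p' : ℝ} (hp : p ∈ Icc a b) (hp' : p' ∈ Icc a' b') (ha : a ≤ a') (hb : b ≤ b')
    (hab : a' < b') (h : ∫ z in a..b, (z - p) * f z = 0)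
    (h' : ∫ z in a'..b', (z - p') * f z = 0) : p ≤ p' := by
  rcases lt_or_ge p a' with hlt | hge
  · exact hlt.le.trans hp'.1
  have hi : ∀ q u v, IntervalIntegrable (fun z => (z - q) * f z) volume u v := fun q u v =>
    Continuous.intervalIntegrable (by fun_prop) _ _
  have hsplit : ∫ z in a'..b', (z - p) * f z =
      (∫ z in b..b', (z - p) * f z) - ∫ z in a..a', (z - p) * f z := by
    have e1 := intervalIntegral.integral_add_adjacent_intervals (hi p a a') (hi p a' b')
    have e2 := intervalIntegral.integral_add_adjacent_intervals (hi p a b) (hi p b b')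
    linarith
  have h1 : 0 ≤ ∫ z in b..b', (z - p) * f z :=
    intervalIntegral.integral_nonneg hb fun z hz =>
      mul_nonneg (by linarith [hz.1, hp.2]) (hpos z).le
  have h2 : ∫ z in a..a', (z - p) * f z ≤ 0 := by
    rw [← neg_nonneg, ← intervalIntegral.integral_neg]
    refine intervalIntegral.integral_nonneg ha fun z hz => ?_
    rw [← neg_mul]
    exact mul_nonneg (by linarith [hz.2]) (hpos z).le
  have h3 : ∫ z in a'..b', (z - p) * f z = (p' - p) * ∫ z in a'..b', f z := by
    rw [← intervalIntegral.integral_const_mul, ← sub_eq_zero, ← h',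
      ← intervalIntegral.integral_sub (hi _ _ _)
        (Continuous.intervalIntegrable (by fun_prop) _ _)]
    refine intervalIntegral.integral_congr fun z _ => ?_
    ring
  have h4 : 0 < ∫ z in a'..b', f z :=
    intervalIntegral.intervalIntegral_pos_of_pos (hf.intervalIntegrable _ _) hpos hab
  have h5 : 0 ≤ (p' - p) * ∫ z in a'..b', f z := by rw [← h3, hsplit]; linarith
  linarith [nonneg_of_mul_nonneg_left h5 h4]

theorem integral_comp_hat {F : ℝ → ℝ} (hF : Measurable F) :
    2 * ∫ t, F (hat t) ∂(uniformLaw 0 1) = ∫ w in (-1)..1, F w := by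
  have h := uniformLaw_centered 0
  simp only [zero_sub, zero_add] at h
  rw [← integral_map measurable_hat.aemeasurable hF.aestronglyMeasurable, ← h, uniformLaw_eq,
    integral_smul_measure, intervalIntegral.integral_of_le (by norm_num),
    integral_Icc_eq_integral_Ioc]
  norm_num
  ring

theorem monotone_sub_posteriorMean_hat {s : ℝ≥0} (hs : s ≠ 0) :
    Monotone fun y => y - posteriorMean (uniformLaw 0 1) hat s y := by
  have hcont : Continuous (gaussianPDFReal 0 s) := by
    unfold gaussianPDFReal
    fun_prop
  have key : ∀ y, ∫ z in (y - 1)..(y + 1),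
      (z - (y - posteriorMean (uniformLaw 0 1) hat s y)) * gaussianPDFReal 0 s z = 0 := by
    intro y
    set d := posteriorMean (uniformLaw 0 1) hat s y with hd
    have h1 := integral_sub_mul_gaussianPDFReal (l := uniformLaw 0 1) measurable_hat abs_hat_le hs
      d y
    rw [← hd, sub_self, zero_mul] at h1
    have h2 := integral_comp_hat (F := fun u => (u - d) * gaussianPDFReal u s y)
      (by unfold gaussianPDFReal; fun_prop)
    rw [h1, mul_zero] at h2
    have h3 := intervalIntegral.integral_comp_sub_left (a := -1) (b := 1)
      (fun z => (z - (y - d)) * gaussianPDFReal 0 s z) y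
    rw [sub_neg_eq_add] at h3
    rw [← h3, ← neg_eq_zero, ← intervalIntegral.integral_neg]
    refine Eq.trans ?_ h2.symm
    refine intervalIntegral.integral_congr fun u _ => ?_
    simp only [gaussianPDFReal]
    ring_nf
  have hmem : ∀ y, y - posteriorMean (uniformLaw 0 1) hat s y ∈ Icc (y - 1) (y + 1) := fun y => by
    have := abs_le.1 (abs_posteriorMean_le (l := uniformLaw 0 1) measurable_hat abs_hat_le hs y)
    exact ⟨by linarith [this.2], by linarith [this.1]⟩
  intro y z hyz
  exact truncated_mean_mono hcont (fun z => gaussianPDFReal_pos 0 s z hs) (hmem y) (hmem z)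
    (by linarith) (by linarith) (by linarith) (key y) (key z)

/-- The optimal denoiser for the uniform laws on `[m x - 1, m x + 1]`. -/
noncomputable def limitDenoiser (m : ℝ → ℝ) (s : ℝ≥0) (v x : ℝ) : ℝ :=
  posteriorMean (uniformLaw 0 1) (fun t => m x + hat t) s v

theorem limitDenoiser_eq (m : ℝ → ℝ) {s : ℝ≥0} (hs : s ≠ 0) (v x : ℝ) :
    limitDenoiser m s v x = m x + posteriorMean (uniformLaw 0 1) hat s (v - m x) :=
  posteriorMean_const_add _ _ measurable_hat abs_hat_le hs _

theorem abs_limitDenoiser_sub_le (m : ℝ → ℝ) {s : ℝ≥0} (hs : s ≠ 0) (v x : ℝ) :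
    |limitDenoiser m s v x - m x| ≤ 1 := by
  rw [limitDenoiser_eq m hs, add_sub_cancel_left]
  exact abs_posteriorMean_le measurable_hat abs_hat_le hs _

theorem abs_limitDenoiser_sub_limitDenoiser_le (m : ℝ → ℝ) {s : ℝ≥0} (hs : s ≠ 0)
    (v x v' x' : ℝ) :
    |limitDenoiser m s v x - limitDenoiser m s v' x'| ≤ |v - v'| + |m x - m x'| := by
  rw [limitDenoiser_eq m hs, limitDenoiser_eq m hs]
  have h1 := monotone_posteriorMean (l := uniformLaw 0 1) measurable_hat abs_hat_le hs
  have h2 := monotone_sub_posteriorMean_hat hs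
  set d := posteriorMean (uniformLaw 0 1) hat s
  have hv := abs_le.1 (le_refl |v - v'|)
  have hm := abs_le.1 (le_refl |m x - m x'|)
  rcases le_total (v - m x) (v' - m x') with h | h <;>
  · have h3 := h1 h
    have h4 := h2 h
    simp only at h4
    rw [abs_le]
    constructor <;> linarith [hv.1, hv.2, hm.1, hm.2]

theorem integral_uniformLaw_zero_one (f : ℝ → ℝ) :
    ∫ x, f x ∂(uniformLaw 0 1) = ∫ x in (0 : ℝ)..1, f x := by
  rw [uniformLaw_zero_one, integral_Icc_eq_integral_Ioc,
    intervalIntegral.integral_of_le zero_le_one]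

/-- Averaging of a function of a slow variable and a fast periodic variable. -/
theorem abs_integral_fast_slow_sub_le {H : ℝ → ℝ → ℝ} (hH : Measurable (Function.uncurry H))
    (hper : ∀ x, Function.Periodic (fun t => H t x) 1) {B M : ℝ}
    (hB : ∀ t x, H t x ∈ Icc 0 B) (hM : ∀ t x x', |H t x - H t x'| ≤ M * |x - x'|)
    {Δ : ℝ} (hΔ : 0 < Δ) :
    |(∫ x, H (x / Δ) x ∂(uniformLaw 0 1)) - ∫ x, ∫ t, H t x ∂(uniformLaw 0 1) ∂(uniformLaw 0 1)|
      ≤ (M + B) * Δ := by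
  have hB0 : 0 ≤ B := (hB 0 0).1.trans (hB 0 0).2
  have hM0 : 0 ≤ M := by simpa using (abs_nonneg _).trans (hM 0 1 0)
  have habs : ∀ t x, ‖H t x‖ ≤ B := fun t x => by
    rw [Real.norm_of_nonneg (hB t x).1]
    exact (hB t x).2
  have hcomp : ∀ {p q : ℝ → ℝ}, Measurable p → Measurable q → Measurable fun y => H (p y) (q y) :=
    fun hp hq => hH.comp (hp.prodMk hq)
  have hii : ∀ {p q : ℝ → ℝ}, Measurable p → Measurable q → ∀ a b,
      IntervalIntegrable (fun y => H (p y) (q y)) volume a b := fun hp hq a b =>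
    (intervalIntegrable_const (c := B)).mono_fun (hcomp hp hq).aestronglyMeasurable
      (.of_forall fun y => (habs _ _).trans (le_abs_self B))
  set I : ℝ → ℝ := fun s => ∫ x in (0 : ℝ)..1, H (x / Δ + s) x with hI
  have hclose : ∀ s ∈ Icc (0 : ℝ) 1, |I s - I 0| ≤ (M + B) * Δ := by
    intro s hs
    have ha : 0 ≤ s * Δ := mul_nonneg hs.1 hΔ.le
    set a := s * Δ with haΔ
    set φ : ℝ → ℝ := fun y => H (y / Δ) y with hφ
    have hφi : ∀ u v, IntervalIntegrable φ volume u v :=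
      hii (measurable_id.div_const Δ) measurable_id
    have e0 : I 0 = ∫ y in (0 : ℝ)..1, φ y := by simp [hI, hφ]
    have e1 : ∫ x in (0 : ℝ)..1, φ (x + a) = I 0 + (∫ y in (1 : ℝ)..(1 + a), φ y) -
        ∫ y in (0 : ℝ)..a, φ y := by
      rw [intervalIntegral.integral_comp_add_right, zero_add, e0]
      have f1 := intervalIntegral.integral_add_adjacent_intervals (hφi 0 1) (hφi 1 (1 + a))
      have f2 := intervalIntegral.integral_add_adjacent_intervals (hφi 0 a) (hφi a (1 + a))
      linarith
    have hrange : ∀ u v, u ≤ v → (∫ y in u..v, φ y) ∈ Icc 0 (B * (v - u)) := fun u v huv => by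
      refine ⟨intervalIntegral.integral_nonneg huv fun y _ => (hB _ _).1, ?_⟩
      have := intervalIntegral.integral_mono_on huv (hφi u v) intervalIntegrable_const
        fun y _ => (hB (y / Δ) y).2
      simpa [mul_comm] using this
    have g1 := hrange 1 (1 + a) (by linarith)
    have g2 := hrange 0 a ha
    have e2 : |I s - ∫ x in (0 : ℝ)..1, φ (x + a)| ≤ M * a := by
      have j1 := hii (p := fun x => x / Δ + s) (q := fun x => x) (by fun_prop) (by fun_prop) 0 1
      have j2 := hii (p := fun x => (x + a) / Δ) (q := fun x => x + a)
        (by fun_prop) (by fun_prop) 0 1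
      rw [hI, hφ]
      simp only
      rw [← intervalIntegral.integral_sub j1 j2, ← Real.norm_eq_abs]
      have := intervalIntegral.norm_integral_le_of_norm_le_const (a := (0 : ℝ)) (b := 1)
        (f := fun x => H (x / Δ + s) x - H ((x + a) / Δ) (x + a)) (C := M * a) fun x _ => by
          have hx : (x + a) / Δ = x / Δ + s := by rw [haΔ]; field_simp
          rw [hx, Real.norm_eq_abs]
          refine (hM _ _ _).trans_eq ?_
          rw [sub_add_cancel_left, abs_neg, abs_of_nonneg ha]
      simpa using this
    rw [e1] at e2
    have e3 := abs_le.1 e2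
    have hle : (M + B) * a ≤ (M + B) * Δ :=
      mul_le_mul_of_nonneg_left (by rw [haΔ]; nlinarith [hs.2]) (by positivity)
    rw [abs_le]
    constructor <;> linarith [g1.1, g1.2, g2.1, g2.2, e3.1, e3.2]
  have hIm : Measurable I := by
    have hm : Measurable fun q : ℝ × ℝ => H (q.2 / Δ + q.1) q.2 :=
      hH.comp (f := fun q : ℝ × ℝ => (q.2 / Δ + q.1, q.2)) (by fun_prop)
    simp only [hI, intervalIntegral.integral_of_le zero_le_one]
    exact (hm.stronglyMeasurable.integral_prod_right').measurable
  have hIb : ∀ s, ‖I s‖ ≤ B := fun s => by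
    simpa using intervalIntegral.norm_integral_le_of_norm_le_const (a := (0 : ℝ)) (b := 1)
      (f := fun x => H (x / Δ + s) x) (C := B) fun x _ => habs _ _
  have hIi : IntervalIntegrable I volume 0 1 :=
    (intervalIntegrable_const (c := B)).mono_fun hIm.aestronglyMeasurable
      (.of_forall fun y => (hIb _).trans (le_abs_self B))
  have hswap : ∫ x, ∫ t, H t x ∂(uniformLaw 0 1) ∂(uniformLaw 0 1) = ∫ s in (0 : ℝ)..1, I s := by
    have hinner : ∀ x, ∫ t, H t x ∂(uniformLaw 0 1) = ∫ s, H (x / Δ + s) x ∂(uniformLaw 0 1) := by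
      intro x
      rw [integral_uniformLaw_zero_one, integral_uniformLaw_zero_one,
        intervalIntegral.integral_comp_add_left (fun t => H t x), add_zero]
      have := (hper x).intervalIntegral_add_eq 0 (x / Δ)
      rwa [zero_add] at this
    simp_rw [hinner]
    rw [integral_integral_swap, integral_uniformLaw_zero_one]
    · simp_rw [integral_uniformLaw_zero_one, hI]
    · refine Integrable.of_bound (C := B) ?_ (.of_forall fun q => habs _ _)
      have hm : Measurable fun q : ℝ × ℝ => H (q.1 / Δ + q.2) q.1 :=
        hH.comp (f := fun q : ℝ × ℝ => (q.1 / Δ + q.2, q.1)) (by fun_prop)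
      exact hm.aestronglyMeasurable
  have e0 : ∫ x, H (x / Δ) x ∂(uniformLaw 0 1) = ∫ s in (0 : ℝ)..1, I 0 := by
    rw [integral_uniformLaw_zero_one]
    simp [hI]
  rw [hswap, e0, abs_sub_comm, ← intervalIntegral.integral_sub hIi intervalIntegrable_const,
    ← Real.norm_eq_abs]
  have := intervalIntegral.norm_integral_le_of_norm_le_const (a := (0 : ℝ)) (b := 1)
    (f := fun s => I s - I 0) (C := (M + B) * Δ) fun s hs => by
      rw [uIoc_of_le zero_le_one] at hs
      exact hclose s ⟨hs.1.le, hs.2⟩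
  simpa using this

/-- The nearest point of `[0, 1]`. -/
noncomputable def clamp (x : ℝ) : ℝ := max 0 (min 1 x)

theorem clamp_mem (x : ℝ) : clamp x ∈ Icc (0 : ℝ) 1 :=
  ⟨le_max_left _ _, max_le zero_le_one (min_le_left _ _)⟩

theorem clamp_of_mem {x : ℝ} (hx : x ∈ Icc (0 : ℝ) 1) : clamp x = x := by
  rw [clamp, min_eq_right hx.2, max_eq_right hx.1]

theorem continuous_clamp : Continuous clamp := by
  unfold clamp
  fun_prop

theorem abs_clamp_sub_le (x y : ℝ) : |clamp x - clamp y| ≤ |x - y| := by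
  unfold clamp
  grind

theorem abs_clamp_sub_le_one (x y : ℝ) : |clamp x - clamp y| ≤ 1 := by
  have hx := clamp_mem x
  have hy := clamp_mem y
  rw [abs_le]
  constructor <;> linarith [hx.1, hx.2, hy.1, hy.2]

theorem sqrt_sq_add_sq_le (a b : ℝ) : √(a ^ 2 + b ^ 2) ≤ |a| + |b| := by
  rw [Real.sqrt_le_left (by positivity)]
  nlinarith [sq_abs a, sq_abs b, abs_nonneg a, abs_nonneg b,
    mul_nonneg (abs_nonneg a) (abs_nonneg b)]

section

variable {L : ℝ} {D : ℝ → ℝ → ℝ}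

theorem LipschitzDenoiser.nonneg (hD : LipschitzDenoiser L D) : 0 ≤ L := by
  have h := (abs_nonneg _).trans (hD 1 0 0 (by simp) 0 (by simp))
  simpa using h

theorem LipschitzDenoiser.abs_clamp_le (hD : LipschitzDenoiser L D) (u x u' x' : ℝ) :
    |D u (clamp x) - D u' (clamp x')| ≤ L * (|u - u'| + |clamp x - clamp x'|) :=
  (hD u u' _ (clamp_mem x) _ (clamp_mem x')).trans
    (mul_le_mul_of_nonneg_left (sqrt_sq_add_sq_le _ _) hD.nonneg)

theorem LipschitzDenoiser.continuous (hD : LipschitzDenoiser L D) :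
    Continuous fun p : ℝ × ℝ => D p.1 (clamp p.2) := by
  refine continuous_iff_continuousAt.2 fun p => ?_
  rw [ContinuousAt, tendsto_iff_dist_tendsto_zero]
  have hc : Continuous fun q : ℝ × ℝ => L * (|q.1 - p.1| + |clamp q.2 - clamp p.2|) := by
    have := continuous_clamp
    fun_prop
  have h0 := hc.tendsto p
  simp only [sub_self, abs_zero, add_zero, mul_zero] at h0
  exact squeeze_zero (fun _ => dist_nonneg) (fun q => hD.abs_clamp_le _ _ _ _) h0

instance isProbabilityMeasure_noise (σ : ℝ) : IsProbabilityMeasure (noise σ) := by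
  unfold noise
  infer_instance

/-- The mean square error of the denoiser `D` at a sample `u`, for the input `clamp x`. -/
noncomputable def sqError (σ : ℝ) (D : ℝ → ℝ → ℝ) (u x : ℝ) : ℝ :=
  ∫ η, (D (u + η) (clamp x) - u) ^ 2 ∂(noise σ)

theorem memLp_id_noise (σ : ℝ) : MemLp (fun η : ℝ => η) 2 (noise σ) :=
  memLp_id_gaussianReal 2

theorem LipschitzDenoiser.measurable_sub (hD : LipschitzDenoiser L D) (u x : ℝ) :
    Measurable fun η => D (u + η) (clamp x) - u :=
  (hD.continuous.comp (f := fun η => (u + η, x)) (by fun_prop)).measurable.sub_const u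

theorem LipschitzDenoiser.memLp (hD : LipschitzDenoiser L D) (σ u x : ℝ) :
    MemLp (fun η => D (u + η) (clamp x) - u) 2 (noise σ) := by
  have h0 : MemLp (fun _ : ℝ => |D u (clamp x) - u|) 2 (noise σ) := memLp_const _
  have h0' : MemLp (fun η : ℝ => L * |η|) 2 (noise σ) := (memLp_id_noise σ).abs.const_mul L
  have h1 : MemLp (fun η : ℝ => |D u (clamp x) - u| + L * |η|) 2 (noise σ) := h0.add h0'
  refine h1.mono' (hD.measurable_sub u x).aestronglyMeasurable (.of_forall fun η => ?_)
  have h2 := hD.abs_clamp_le (u + η) x u x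
  rw [add_sub_cancel_left, sub_self, abs_zero, add_zero] at h2
  rw [Real.norm_eq_abs]
  calc |D (u + η) (clamp x) - u|
      = |(D u (clamp x) - u) + (D (u + η) (clamp x) - D u (clamp x))| := by ring_nf
    _ ≤ _ := (abs_add_le _ _).trans (by linarith)

theorem LipschitzDenoiser.integrable_sq (hD : LipschitzDenoiser L D) (σ u x : ℝ) :
    Integrable (fun η => (D (u + η) (clamp x) - u) ^ 2) (noise σ) :=
  (hD.memLp σ u x).integrable_sq

theorem sqError_nonneg (σ : ℝ) (D : ℝ → ℝ → ℝ) (u x : ℝ) : 0 ≤ sqError σ D u x :=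
  integral_nonneg fun _ => sq_nonneg _

theorem LipschitzDenoiser.ofReal_sqError (hD : LipschitzDenoiser L D) (σ u x : ℝ) :
    ENNReal.ofReal (sqError σ D u x) =
      ∫⁻ η, ENNReal.ofReal ((D (u + η) (clamp x) - u) ^ 2) ∂(noise σ) :=
  ofReal_integral_eq_lintegral_ofReal (hD.integrable_sq σ u x) (.of_forall fun _ => sq_nonneg _)

theorem LipschitzDenoiser.measurable_sqError (hD : LipschitzDenoiser L D) (σ : ℝ) :
    Measurable fun p : ℝ × ℝ => sqError σ D p.1 p.2 := by
  have hm : Measurable fun q : (ℝ × ℝ) × ℝ => (D (q.1.1 + q.2) (clamp q.1.2) - q.1.1) ^ 2 := by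
    have : Measurable fun q : (ℝ × ℝ) × ℝ => D (q.1.1 + q.2) (clamp q.1.2) :=
      (hD.continuous.comp (f := fun q : (ℝ × ℝ) × ℝ => (q.1.1 + q.2, q.1.2))
        (by fun_prop)).measurable
    exact (this.sub (by fun_prop)).pow_const 2
  exact (hm.stronglyMeasurable.integral_prod_right').measurable

theorem LipschitzDenoiser.abs_error_sub_le (hD : LipschitzDenoiser L D) {δ : ℝ} {u x u' x' : ℝ}
    (hδ : (L + 1) * (|u - u'| + |clamp x - clamp x'|) ≤ δ) (η : ℝ) :
    |(D (u + η) (clamp x) - u) - (D (u' + η) (clamp x') - u')| ≤ δ := by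
  have h := hD.abs_clamp_le (u + η) x (u' + η) x'
  rw [add_sub_add_right_eq_sub] at h
  calc _ = |(D (u + η) (clamp x) - D (u' + η) (clamp x')) - (u - u')| := by ring_nf
    _ ≤ _ := abs_sub _ _
    _ ≤ _ := by nlinarith [abs_nonneg (clamp x - clamp x')]

theorem LipschitzDenoiser.sqError_le (hD : LipschitzDenoiser L D) (σ : ℝ) {δ : ℝ} {u x u' x' : ℝ}
    (hδ : (L + 1) * (|u - u'| + |clamp x - clamp x'|) ≤ δ) :
    sqError σ D u x ≤ 2 * sqError σ D u' x' + 2 * δ ^ 2 := by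
  have hi := hD.integrable_sq σ
  calc sqError σ D u x
      ≤ ∫ η, (2 * (D (u' + η) (clamp x') - u') ^ 2 + 2 * δ ^ 2) ∂(noise σ) := by
        refine integral_mono (hi u x) (((hi u' x').const_mul 2).add (integrable_const _))
          fun η => ?_
        have h := hD.abs_error_sub_le hδ η
        simp only
        set A := D (u + η) (clamp x) - u
        set A' := D (u' + η) (clamp x') - u'
        nlinarith [sq_nonneg (2 * A' - A), abs_le.1 h, sq_abs (A - A'), abs_nonneg (A - A'),
          pow_le_pow_left₀ (abs_nonneg _) h 2]
    _ = _ := by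
        rw [integral_add ((hi u' x').const_mul 2) (integrable_const _), integral_const_mul]
        simp [sqError]

theorem LipschitzDenoiser.abs_sqError_sub_le (hD : LipschitzDenoiser L D) (σ : ℝ) {δ : ℝ}
    {u x u' x' : ℝ} (hδ : (L + 1) * (|u - u'| + |clamp x - clamp x'|) ≤ δ) :
    |sqError σ D u x - sqError σ D u' x'| ≤
      δ * ((sqError σ D u x + sqError σ D u' x') / 2 + 1) := by
  have hi := hD.integrable_sq σ
  rw [sqError, sqError, ← integral_sub (hi u x) (hi u' x')]
  refine (abs_integral_le_integral_abs).trans ?_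
  have hsum : Integrable (fun η => ((D (u + η) (clamp x) - u) ^ 2 +
      (D (u' + η) (clamp x') - u') ^ 2) / 2) (noise σ) := ((hi u x).add (hi u' x')).div_const 2
  calc _ ≤ ∫ η, δ * (((D (u + η) (clamp x) - u) ^ 2 + (D (u' + η) (clamp x') - u') ^ 2) / 2 + 1)
          ∂(noise σ) := by
        refine integral_mono ((hi u x).sub (hi u' x')).abs
          ((hsum.add (integrable_const 1)).const_mul δ)
          fun η => ?_
        have h := hD.abs_error_sub_le hδ η
        simp only
        set A := D (u + η) (clamp x) - u
        set A' := D (u' + η) (clamp x') - u'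
        have hA : |A + A'| ≤ (A ^ 2 + A' ^ 2) / 2 + 1 := by
          rw [abs_le]
          constructor <;> nlinarith [sq_nonneg (A - 1), sq_nonneg (A + 1), sq_nonneg (A' - 1),
            sq_nonneg (A' + 1)]
        rw [show A ^ 2 - A' ^ 2 = (A - A') * (A + A') by ring, abs_mul]
        exact mul_le_mul h hA (abs_nonneg _) ((abs_nonneg _).trans h)
    _ = _ := by
        rw [integral_const_mul, integral_add hsum (integrable_const 1), integral_div, integral_add (hi u x) (hi u' x')]
        simp

theorem ae_mem_uniformLaw_zero_one : ∀ᵐ x ∂(uniformLaw 0 1), x ∈ Icc (0 : ℝ) 1 := by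
  rw [uniformLaw_zero_one]
  exact ae_restrict_mem measurableSet_Icc

variable {m : ℝ → ℝ} {K : ℝ≥0}

theorem LipschitzDenoiser.denoisingLoss_dataLaw (hD : LipschitzDenoiser L D) (m : ℝ → ℝ)
    (Δ σ : ℝ) :
    denoisingLoss (dataLaw m Δ) σ D =
      ∫⁻ x, ENNReal.ofReal (sqError σ D (m (clamp x) + hat (x / Δ)) x) ∂(uniformLaw 0 1) := by
  refine lintegral_congr_ae ?_
  filter_upwards [ae_mem_uniformLaw_zero_one] with x hx
  rw [dataLaw, lintegral_dirac, hD.ofReal_sqError, clamp_of_mem hx, toyMap]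

/-- The family of uniform laws on `[m x - 1, m x + 1]`. -/
noncomputable def meanLaw (m : ℝ → ℝ) (x : ℝ) : Measure ℝ := uniformLaw (m x - 1) (m x + 1)

theorem LipschitzDenoiser.denoisingLoss_meanLaw (hD : LipschitzDenoiser L D) (m : ℝ → ℝ)
    (σ : ℝ) :
    denoisingLoss (meanLaw m) σ D = ∫⁻ x, ∫⁻ t,
      ENNReal.ofReal (sqError σ D (m (clamp x) + hat t) x) ∂(uniformLaw 0 1) ∂(uniformLaw 0 1) := by
  refine lintegral_congr_ae ?_
  filter_upwards [ae_mem_uniformLaw_zero_one] with x hx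
  rw [meanLaw, lintegral_uniformLaw_centered]
  refine lintegral_congr fun t => ?_
  rw [hD.ofReal_sqError, clamp_of_mem hx]

/-- A bound for the error of a denoiser of small loss. -/
noncomputable def errorBound (K : ℝ≥0) (L : ℝ) : ℝ := 8 + 2 * ((L + 1) * (K + 3)) ^ 2

/-- The rate at which the loss converges, as the oscillation of the data becomes fast. -/
noncomputable def averagingRate (K : ℝ≥0) (L : ℝ) : ℝ :=
  (L + 1) * (K + 1) * (errorBound K L + 1) + errorBound K L

theorem LipschitzDenoiser.sqError_le_two_mul_add (hD : LipschitzDenoiser L D)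
    (hm : LipschitzWith K m) (σ t x t' x' : ℝ) :
    sqError σ D (m (clamp x) + hat t) x ≤
      2 * sqError σ D (m (clamp x') + hat t') x' + 2 * ((L + 1) * (K + 3)) ^ 2 := by
  refine hD.sqError_le σ ?_
  have h1 : |m (clamp x) - m (clamp x')| ≤ K * |clamp x - clamp x'| := by
    simpa [Real.dist_eq] using hm.dist_le_mul (clamp x) (clamp x')
  have h2 := abs_clamp_sub_le_one x x'
  have h3 := abs_le.1 (abs_hat_le t)
  have h4 := abs_le.1 (abs_hat_le t')
  have h5 : |hat t - hat t'| ≤ 2 := abs_le.2 ⟨by linarith [h3.1, h4.2], by linarith [h3.2, h4.1]⟩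
  have h6 : |m (clamp x) + hat t - (m (clamp x') + hat t')| ≤ K + 2 := by
    rw [add_sub_add_comm]
    refine (abs_add_le _ _).trans ?_
    nlinarith [K.2, abs_nonneg (clamp x - clamp x')]
  exact mul_le_mul_of_nonneg_left (by linarith) (by linarith [hD.nonneg])

theorem LipschitzDenoiser.measurable_uncurry_sqError (hD : LipschitzDenoiser L D)
    (hm : LipschitzWith K m) (σ : ℝ) :
    Measurable (Function.uncurry fun t x => sqError σ D (m (clamp x) + hat t) x) := by
  have h1 : Measurable m := hm.continuous.measurable
  have h2 := continuous_clamp.measurable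
  have h3 := measurable_hat
  exact (hD.measurable_sqError σ).comp (f := fun p : ℝ × ℝ => (m (clamp p.2) + hat p.1, p.2))
    (by fun_prop)

theorem LipschitzDenoiser.integrable_fast (hD : LipschitzDenoiser L D)
    (hm : LipschitzWith K m) (σ Δ : ℝ) :
    Integrable (fun x => sqError σ D (m (clamp x) + hat (x / Δ)) x) (uniformLaw 0 1) := by
  refine Integrable.of_bound (C := 2 * sqError σ D (m (clamp 0) + hat 0) 0 +
    2 * ((L + 1) * (K + 3)) ^ 2) ?_ (.of_forall fun x => ?_)
  · exact ((hD.measurable_uncurry_sqError hm σ).comp (f := fun x => (x / Δ, x))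
      (by fun_prop)).aestronglyMeasurable
  · rw [Real.norm_of_nonneg (sqError_nonneg _ _ _ _)]
    exact hD.sqError_le_two_mul_add hm σ _ _ _ _

theorem LipschitzDenoiser.denoisingLoss_dataLaw_eq_ofReal (hD : LipschitzDenoiser L D)
    (hm : LipschitzWith K m) (Δ σ : ℝ) :
    denoisingLoss (dataLaw m Δ) σ D = ENNReal.ofReal
      (∫ x, sqError σ D (m (clamp x) + hat (x / Δ)) x ∂(uniformLaw 0 1)) := by
  rw [hD.denoisingLoss_dataLaw, ofReal_integral_eq_lintegral_ofReal (hD.integrable_fast hm σ Δ)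
    (.of_forall fun _ => sqError_nonneg _ _ _ _)]

theorem LipschitzDenoiser.sqError_le_errorBound (hD : LipschitzDenoiser L D)
    (hm : LipschitzWith K m) {Δ σ : ℝ} (h4 : denoisingLoss (dataLaw m Δ) σ D ≤ 4) (t x : ℝ) :
    sqError σ D (m (clamp x) + hat t) x ≤ errorBound K L := by
  have hJ : ∫ y, sqError σ D (m (clamp y) + hat (y / Δ)) y ∂(uniformLaw 0 1) ≤ 4 := by
    rw [hD.denoisingLoss_dataLaw_eq_ofReal hm] at h4
    exact (ENNReal.ofReal_le_ofReal_iff (by norm_num)).1 (by simpa using h4)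
  have hi := hD.integrable_fast hm σ Δ
  calc sqError σ D (m (clamp x) + hat t) x
      = ∫ _, sqError σ D (m (clamp x) + hat t) x ∂(uniformLaw 0 1) := by simp
    _ ≤ ∫ y, (2 * sqError σ D (m (clamp y) + hat (y / Δ)) y + 2 * ((L + 1) * (K + 3)) ^ 2)
          ∂(uniformLaw 0 1) :=
        integral_mono (integrable_const _) ((hi.const_mul 2).add (integrable_const _))
          fun y => hD.sqError_le_two_mul_add hm σ _ _ _ _
    _ = 2 * (∫ y, sqError σ D (m (clamp y) + hat (y / Δ)) y ∂(uniformLaw 0 1)) +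
          2 * ((L + 1) * (K + 3)) ^ 2 := by
        rw [integral_add (hi.const_mul 2) (integrable_const _), integral_const_mul]
        simp
    _ ≤ _ := by rw [errorBound]; linarith

/-- The loss for the oscillating data is close to the loss for the uniform laws, uniformly in the
noise level. -/
theorem LipschitzDenoiser.denoisingLoss_close (hD : LipschitzDenoiser L D)
    (hm : LipschitzWith K m) {Δ σ : ℝ} (hΔ : 0 < Δ)
    (h4 : denoisingLoss (dataLaw m Δ) σ D ≤ 4) :
    denoisingLoss (meanLaw m) σ D ≤
        denoisingLoss (dataLaw m Δ) σ D + ENNReal.ofReal (averagingRate K L * Δ) ∧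
      denoisingLoss (dataLaw m Δ) σ D ≤
        denoisingLoss (meanLaw m) σ D + ENNReal.ofReal (averagingRate K L * Δ) := by
  set H : ℝ → ℝ → ℝ := fun t x => sqError σ D (m (clamp x) + hat t) x with hH
  have hL := hD.nonneg
  have hmeas : Measurable (Function.uncurry H) := hD.measurable_uncurry_sqError hm σ
  have hB : ∀ t x, H t x ∈ Icc 0 (errorBound K L) := fun t x =>
    ⟨sqError_nonneg _ _ _ _, hD.sqError_le_errorBound hm h4 t x⟩
  have hB0 := (hB 0 0).1.trans (hB 0 0).2
  have hlip : ∀ t x x', |H t x - H t x'| ≤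
      (L + 1) * (K + 1) * (errorBound K L + 1) * |x - x'| := by
    intro t x x'
    have hδ : (L + 1) * (|m (clamp x) + hat t - (m (clamp x') + hat t)| + |clamp x - clamp x'|) ≤
        (L + 1) * (K + 1) * |x - x'| := by
      rw [add_sub_add_right_eq_sub, mul_assoc]
      have h1 : |m (clamp x) - m (clamp x')| ≤ K * |clamp x - clamp x'| := by
        simpa [Real.dist_eq] using hm.dist_le_mul (clamp x) (clamp x')
      have h2 := abs_clamp_sub_le x x'
      exact mul_le_mul_of_nonneg_left (by nlinarith [K.2]) (by linarith)
    refine (hD.abs_sqError_sub_le σ hδ).trans ?_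
    have h1 := (hB t x).2
    have h2 := (hB t x').2
    simp only [hH] at h1 h2
    calc _ ≤ (L + 1) * (K + 1) * |x - x'| * (errorBound K L + 1) :=
          mul_le_mul_of_nonneg_left (by linarith) (by positivity)
      _ = _ := by ring
  have key := abs_integral_fast_slow_sub_le hmeas
    (fun x t => by simp only [hH, hat_add_one]) hB hlip hΔ
  have hdata := hD.denoisingLoss_dataLaw_eq_ofReal hm Δ σ
  have hin : ∀ x, Integrable (fun t => H t x) (uniformLaw 0 1) := fun x =>
    Integrable.of_bound (C := errorBound K L)
      (hmeas.comp (f := fun t => (t, x)) (by fun_prop)).aestronglyMeasurable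
      (.of_forall fun t => by rw [Real.norm_of_nonneg (hB t x).1]; exact (hB t x).2)
  have hmean : denoisingLoss (meanLaw m) σ D =
      ENNReal.ofReal (∫ x, ∫ t, H t x ∂(uniformLaw 0 1) ∂(uniformLaw 0 1)) := by
    rw [hD.denoisingLoss_meanLaw, ofReal_integral_eq_lintegral_ofReal _
      (.of_forall fun x => integral_nonneg fun t => (hB t x).1)]
    · refine lintegral_congr fun x => ?_
      rw [ofReal_integral_eq_lintegral_ofReal (hin x) (.of_forall fun t => (hB t x).1)]
    · refine Integrable.of_bound (C := errorBound K L) ?_ (.of_forall fun x => ?_)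
      · have hm' : Measurable fun q : ℝ × ℝ => H q.2 q.1 := hmeas.comp measurable_swap
        exact (hm'.stronglyMeasurable.integral_prod_right').aestronglyMeasurable
      · rw [Real.norm_of_nonneg (integral_nonneg fun t => (hB t x).1)]
        simpa using integral_mono (hin x) (integrable_const _) fun t => (hB t x).2
  rw [hdata, hmean]
  have hA : 0 ≤ ∫ x, H (x / Δ) x ∂(uniformLaw 0 1) := integral_nonneg fun x => (hB _ _).1
  have hA' : 0 ≤ ∫ x, ∫ t, H t x ∂(uniformLaw 0 1) ∂(uniformLaw 0 1) :=
    integral_nonneg fun x => integral_nonneg fun t => (hB t x).1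
  have hC : 0 ≤ averagingRate K L * Δ := (abs_nonneg _).trans key
  have h := abs_le.1 key
  rw [← ENNReal.ofReal_add hA hC, ← ENNReal.ofReal_add hA' hC]
  rw [averagingRate]
  exact ⟨ENNReal.ofReal_le_ofReal (by linarith [h.1]), ENNReal.ofReal_le_ofReal (by linarith [h.2])⟩

end

theorem toNNReal_sq_ne_zero {σ : ℝ} (hσ : 0 < σ) : Real.toNNReal (σ ^ 2) ≠ 0 :=
  (Real.toNNReal_pos.2 (by positivity)).ne'

section

variable {D : ℝ → ℝ → ℝ}

theorem measurable_denoiser_section (hD : Measurable (Function.uncurry D)) (x : ℝ) :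
    Measurable fun v => D v x :=
  hD.comp (f := fun v => (v, x)) (by fun_prop)

theorem measurable_lintegral_noise (σ : ℝ) {f : ℝ × ℝ → ℝ → ℝ≥0∞}
    (hf : Measurable (Function.uncurry f)) : Measurable fun q => ∫⁻ η, f q η ∂(noise σ) :=
  Measurable.lintegral_prod_right' (f := Function.uncurry f) hf

theorem denoisingLoss_map {l : Measure ℝ} {g : ℝ → ℝ → ℝ} (hg : Measurable (Function.uncurry g))
    (σ : ℝ) (hD : Measurable (Function.uncurry D)) :
    denoisingLoss (fun x => l.map (g x)) σ D = ∫⁻ x, ∫⁻ w, ∫⁻ η,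
      ENNReal.ofReal ((D (g x w + η) x - g x w) ^ 2) ∂(noise σ) ∂l ∂(uniformLaw 0 1) := by
  refine lintegral_congr fun x => ?_
  rw [lintegral_map]
  · have h1 := measurable_denoiser_section hD x
    exact (measurable_lintegral_noise σ (f := fun q η => ENNReal.ofReal
      ((D (q.1 + η) x - q.1) ^ 2)) (by unfold Function.uncurry; fun_prop)).comp
        (f := fun u : ℝ => (u, (0 : ℝ))) (by fun_prop)
  · exact hg.comp (f := fun w => (x, w)) (by fun_prop)

theorem abs_add_hat_le (c t : ℝ) : |c + hat t| ≤ |c| + 1 :=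
  (abs_add_le _ _).trans (by linarith [abs_hat_le t])

theorem exists_isOptimalDenoiser_smoothedLaw {m : ℝ → ℝ} (hm : Measurable m) {ε : ℝ} (hε : 0 < ε)
    (Δ : ℝ) {σ : ℝ} (hσ : 0 < σ) :
    ∃ D : ℝ → ℝ → ℝ, IsOptimalDenoiser (smoothedLaw m ε Δ) σ D := by
  have := isProbabilityMeasure_uniformLaw (neg_lt_self hε)
  set g : ℝ → ℝ → ℝ := fun x w => m x + hat ((x + w) / Δ) with hg
  have hgm : Measurable (Function.uncurry g) := by
    have := measurable_hat
    unfold Function.uncurry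
    fun_prop
  have hgx : ∀ x, Measurable (g x) := fun x => hgm.comp (f := fun w => (x, w)) (by fun_prop)
  have hp : Measurable (Function.uncurry fun v x =>
      posteriorMean (uniformLaw (-ε) ε) (g x) (Real.toNNReal (σ ^ 2)) v) :=
    measurable_posteriorMean_uncurry (l := uniformLaw (-ε) ε) hgm (Real.toNNReal (σ ^ 2))
  refine ⟨_, hp, fun D' hD' => ?_⟩
  have e : smoothedLaw m ε Δ = fun x => (uniformLaw (-ε) ε).map (g x) := rfl
  rw [e, denoisingLoss_map hgm σ hp, denoisingLoss_map hgm σ hD']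
  refine lintegral_mono fun x => ?_
  have := lintegral_denoising_eq_add (l := uniformLaw (-ε) ε) (hgx x)
    (fun w => abs_add_hat_le (m x) _) (toNNReal_sq_ne_zero hσ) (measurable_denoiser_section hD' x)
  exact le_self_add.trans this.symm.le

variable {m : ℝ → ℝ}

theorem measurable_add_hat (hm : Measurable m) :
    Measurable (Function.uncurry fun x t => m x + hat t) := by
  have := measurable_hat
  unfold Function.uncurry
  fun_prop

theorem lintegral_limitLaw (hm : Measurable m) {f : ℝ × ℝ → ℝ≥0∞} (hf : Measurable f) :
    ∫⁻ q, f q ∂(limitLaw m) =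
      ∫⁻ x, ∫⁻ t, f (m x + hat t, x) ∂(uniformLaw 0 1) ∂(uniformLaw 0 1) := by
  set S : Set (ℝ × ℝ) := {p : ℝ × ℝ | p.2 ∈ Icc 0 1 ∧ p.1 ∈ Icc (m p.2 - 1) (m p.2 + 1)} with hS
  have hSm : MeasurableSet S := by
    have h1 : MeasurableSet {p : ℝ × ℝ | p.2 ∈ Icc (0 : ℝ) 1} := measurable_snd measurableSet_Icc
    have h2 : MeasurableSet {p : ℝ × ℝ | m p.2 - 1 ≤ p.1} :=
      measurableSet_le (by fun_prop) (by fun_prop)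
    have h3 : MeasurableSet {p : ℝ × ℝ | p.1 ≤ m p.2 + 1} :=
      measurableSet_le (by fun_prop) (by fun_prop)
    exact h1.inter (h2.inter h3)
  have key : ∀ h : ℝ × ℝ → ℝ≥0∞, Measurable h → ∫⁻ q in S, h q =
      2 * ∫⁻ x, ∫⁻ t, h (m x + hat t, x) ∂(uniformLaw 0 1) ∂(uniformLaw 0 1) := by
    intro h hh
    rw [← lintegral_indicator hSm, Measure.volume_eq_prod,
      lintegral_prod_symm _ (hh.indicator hSm).aemeasurable]
    have hsec : ∀ x, ∫⁻ u, S.indicator h (u, x) = (Icc (0 : ℝ) 1).indicator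
        (fun x => 2 * ∫⁻ t, h (m x + hat t, x) ∂(uniformLaw 0 1)) x := by
      intro x
      by_cases hx : x ∈ Icc (0 : ℝ) 1
      · rw [indicator_of_mem hx, ← lintegral_uniformLaw_centered (m x) (fun u => h (u, x)),
          lintegral_uniformLaw, ← lintegral_indicator measurableSet_Icc, ← mul_assoc]
        have h2 : ENNReal.ofReal (m x + 1 - (m x - 1)) = 2 := by
          ring_nf
          simp
        rw [h2, ENNReal.mul_inv_cancel (by norm_num) (by norm_num), one_mul]
        refine lintegral_congr fun u => ?_
        by_cases hu : u ∈ Icc (m x - 1) (m x + 1)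
        · rw [indicator_of_mem (show (u, x) ∈ S from ⟨hx, hu⟩), indicator_of_mem hu]
        · rw [indicator_of_notMem (show (u, x) ∉ S from fun H => hu H.2), indicator_of_notMem hu]
      · rw [indicator_of_notMem hx]
        simp [indicator_of_notMem (show (_, x) ∉ S from fun H => hx H.1)]
    simp_rw [hsec]
    rw [lintegral_indicator measurableSet_Icc, ← uniformLaw_zero_one, lintegral_const_mul']
    norm_num
  have hvol : volume S = 2 := by
    have := key 1 measurable_one
    simpa using this
  rw [limitLaw, ProbabilityTheory.cond, lintegral_smul_measure, hvol, key f hf, smul_eq_mul,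
    ← mul_assoc, ENNReal.inv_mul_cancel (by norm_num) (by norm_num), one_mul]

theorem measurable_limitDenoiser (hm : Measurable m) (s : ℝ≥0) :
    Measurable (Function.uncurry (limitDenoiser m s)) :=
  measurable_posteriorMean_uncurry (l := uniformLaw 0 1) (measurable_add_hat hm) s

theorem meanLaw_eq (m : ℝ → ℝ) :
    meanLaw m = fun x => (uniformLaw 0 1).map fun t => m x + hat t :=
  funext fun x => uniformLaw_centered (m x)

theorem measurable_sq_sub {D₁ D₂ : ℝ → ℝ → ℝ} (h₁ : Measurable (Function.uncurry D₁))
    (h₂ : Measurable (Function.uncurry D₂)) :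
    Measurable (Function.uncurry fun (q : ℝ × ℝ) η =>
      ENNReal.ofReal ((D₁ (q.1 + η) q.2 - D₂ (q.1 + η) q.2) ^ 2)) := by
  have e₁ : Measurable fun p : (ℝ × ℝ) × ℝ => D₁ (p.1.1 + p.2) p.1.2 :=
    h₁.comp (f := fun p : (ℝ × ℝ) × ℝ => (p.1.1 + p.2, p.1.2)) (by fun_prop)
  have e₂ : Measurable fun p : (ℝ × ℝ) × ℝ => D₂ (p.1.1 + p.2) p.1.2 :=
    h₂.comp (f := fun p : (ℝ × ℝ) × ℝ => (p.1.1 + p.2, p.1.2)) (by fun_prop)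
  exact ((e₁.sub e₂).pow_const 2).ennreal_ofReal

/-- The excess loss of a denoiser for the uniform laws. -/
theorem denoisingLoss_meanLaw_eq_add (hm : Measurable m) {σ : ℝ} (hσ : 0 < σ)
    (hD : Measurable (Function.uncurry D)) :
    denoisingLoss (meanLaw m) σ D =
      denoisingLoss (meanLaw m) σ (limitDenoiser m (Real.toNNReal (σ ^ 2))) +
        denoiserSqDist m σ D (limitDenoiser m (Real.toNNReal (σ ^ 2))) := by
  set s := Real.toNNReal (σ ^ 2) with hs
  have hg := measurable_add_hat hm
  have hL := measurable_limitDenoiser hm s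
  have hin := measurable_lintegral_noise σ (measurable_sq_sub hD hL)
  rw [meanLaw_eq, denoisingLoss_map hg σ hD, denoisingLoss_map hg σ hL, denoiserSqDist,
    lintegral_limitLaw hm hin, ← lintegral_add_right]
  · refine lintegral_congr fun x => ?_
    exact lintegral_denoising_eq_add (l := uniformLaw 0 1) (measurable_hat.const_add (m x))
      (fun w => abs_add_hat_le (m x) _) (toNNReal_sq_ne_zero hσ)
      (measurable_denoiser_section hD x)
  · exact Measurable.lintegral_prod_right' (ν := uniformLaw 0 1)
      (hin.comp (f := fun p : ℝ × ℝ => (m p.1 + hat p.2, p.1))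
        (hg.prodMk measurable_fst))

theorem denoiserSqDist_triangle {D₁ D₂ D₃ : ℝ → ℝ → ℝ} (σ : ℝ)
    (h₁ : Measurable (Function.uncurry D₁)) (h₂ : Measurable (Function.uncurry D₂)) :
    denoiserSqDist m σ D₁ D₃ ≤ 2 * denoiserSqDist m σ D₁ D₂ + 2 * denoiserSqDist m σ D₃ D₂ := by
  have h := measurable_sq_sub h₁ h₂
  have hin := measurable_lintegral_noise σ h
  unfold denoiserSqDist
  rw [← mul_add, ← lintegral_add_left hin, ← lintegral_const_mul' _ _ (by norm_num)]
  refine lintegral_mono fun q => ?_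
  have hq : Measurable fun η => ENNReal.ofReal ((D₁ (q.1 + η) q.2 - D₂ (q.1 + η) q.2) ^ 2) :=
    h.comp (f := fun η => (q, η)) (by fun_prop)
  simp only
  rw [← lintegral_add_left hq, ← lintegral_const_mul' _ _ (by norm_num)]
  refine lintegral_mono fun η => ?_
  set a := D₁ (q.1 + η) q.2
  set b := D₂ (q.1 + η) q.2
  set c := D₃ (q.1 + η) q.2
  simp only
  rw [← ENNReal.ofReal_add (sq_nonneg _) (sq_nonneg _), ← ENNReal.ofReal_ofNat 2,
    ← ENNReal.ofReal_mul (by norm_num)]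
  exact ENNReal.ofReal_le_ofReal (by nlinarith [sq_nonneg ((a - b) + (c - b))])

theorem denoisingLoss_le_mul {p p' : ℝ → Measure ℝ} {c : ℝ≥0∞} (hc : c ≠ ∞)
    (h : ∀ x ∈ Icc (0 : ℝ) 1, p x ≤ c • p' x) (σ : ℝ) (D : ℝ → ℝ → ℝ) :
    denoisingLoss p σ D ≤ c * denoisingLoss p' σ D := by
  unfold denoisingLoss
  rw [← lintegral_const_mul' _ _ hc]
  refine lintegral_mono_ae ?_
  filter_upwards [ae_mem_uniformLaw_zero_one] with x hx
  rw [← smul_eq_mul, ← lintegral_smul_measure]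
  exact lintegral_mono' (h x hx) le_rfl

theorem mul_denoisingLoss_le {p p' : ℝ → Measure ℝ} {c : ℝ≥0∞} (hc : c ≠ ∞)
    (h : ∀ x ∈ Icc (0 : ℝ) 1, c • p' x ≤ p x) (σ : ℝ) (D : ℝ → ℝ → ℝ) :
    c * denoisingLoss p' σ D ≤ denoisingLoss p σ D := by
  unfold denoisingLoss
  rw [← lintegral_const_mul' _ _ hc]
  refine lintegral_mono_ae ?_
  filter_upwards [ae_mem_uniformLaw_zero_one] with x hx
  rw [← smul_eq_mul, ← lintegral_smul_measure]
  exact lintegral_mono' (h x hx) le_rfl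

theorem lipschitzDenoiser_limitDenoiser {K : ℝ≥0} (hm : LipschitzWith K m) {s : ℝ≥0} (hs : s ≠ 0)
    {L : ℝ} (hL : K + 1 ≤ L) : LipschitzDenoiser L (limitDenoiser m s) := by
  intro u u' x _ x' _
  have h1 := abs_limitDenoiser_sub_limitDenoiser_le m hs u x u' x'
  have h2 : |m x - m x'| ≤ K * |x - x'| := by
    simpa [Real.dist_eq] using hm.dist_le_mul x x'
  have h3 : |u - u'| ≤ √((u - u') ^ 2 + (x - x') ^ 2) :=
    Real.abs_le_sqrt (by nlinarith [sq_nonneg (x - x')])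
  have h4 : |x - x'| ≤ √((u - u') ^ 2 + (x - x') ^ 2) :=
    Real.abs_le_sqrt (by nlinarith [sq_nonneg (u - u')])
  have h5 := mul_le_mul_of_nonneg_left h4 K.2
  have h6 := mul_le_mul_of_nonneg_right hL (Real.sqrt_nonneg ((u - u') ^ 2 + (x - x') ^ 2))
  have h7 : (K : ℝ) * |x - x'| ≤ K * √((u - u') ^ 2 + (x - x') ^ 2) := h5
  linarith

theorem lintegral_le_of_le_four {α : Type*} [MeasurableSpace α] {μ : Measure α}
    [IsProbabilityMeasure μ] {f : α → ℝ≥0∞} (h : ∀ a, f a ≤ 4) : ∫⁻ a, f a ∂μ ≤ 4 :=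
  (lintegral_mono h).trans (by simp)

theorem ofReal_sq_sub_le_four {a b c : ℝ} (ha : |a - c| ≤ 1) (hb : |b - c| ≤ 1) :
    ENNReal.ofReal ((a - b) ^ 2) ≤ 4 := by
  rw [← ENNReal.ofReal_ofNat 4]
  refine ENNReal.ofReal_le_ofReal ?_
  have h1 := abs_le.1 ha
  have h2 := abs_le.1 hb
  nlinarith [h1.1, h1.2, h2.1, h2.2]

theorem denoisingLoss_dataLaw_le_four {Δ σ : ℝ} (hD : ∀ u x, |D u x - m x| ≤ 1) :
    denoisingLoss (dataLaw m Δ) σ D ≤ 4 := by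
  refine lintegral_le_of_le_four fun x => ?_
  rw [dataLaw, lintegral_dirac]
  refine lintegral_le_of_le_four fun η => ofReal_sq_sub_le_four (hD _ _) ?_
  rw [toyMap, add_sub_cancel_left]
  exact abs_hat_le _

theorem denoisingLoss_meanLaw_le_four {σ : ℝ} (hD : ∀ u x, |D u x - m x| ≤ 1) :
    denoisingLoss (meanLaw m) σ D ≤ 4 := by
  refine lintegral_le_of_le_four fun x => ?_
  rw [meanLaw, lintegral_uniformLaw_centered]
  refine lintegral_le_of_le_four fun t =>
    lintegral_le_of_le_four fun η => ofReal_sq_sub_le_four (hD _ _) ?_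
  rw [add_sub_cancel_left]
  exact abs_hat_le _

theorem denoisingLoss_clamp (p : ℝ → Measure ℝ) (σ : ℝ) (D : ℝ → ℝ → ℝ) :
    denoisingLoss p σ (fun u x => D u (clamp x)) = denoisingLoss p σ D := by
  refine lintegral_congr_ae ?_
  filter_upwards [ae_mem_uniformLaw_zero_one] with x hx
  simp only [clamp_of_mem hx]

theorem denoiserSqDist_clamp (hm : Measurable m) (σ : ℝ) (D₁ D₂ : ℝ → ℝ → ℝ) :
    denoiserSqDist m σ (fun u x => D₁ u (clamp x)) D₂ = denoiserSqDist m σ D₁ D₂ := by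
  refine lintegral_congr_ae ?_
  have h : ∀ᵐ q ∂(limitLaw m), q.2 ∈ Icc (0 : ℝ) 1 := by
    have hS : MeasurableSet {q : ℝ × ℝ | q.2 ∈ Icc (0 : ℝ) 1} := measurable_snd measurableSet_Icc
    have h0 := lintegral_limitLaw hm (measurable_one.indicator hS.compl)
    rw [lintegral_indicator_one hS.compl] at h0
    change limitLaw m _ᶜ = 0
    refine h0.trans ((lintegral_congr_ae ?_).trans lintegral_zero)
    filter_upwards [ae_mem_uniformLaw_zero_one] with x hx
    simp [indicator, hx.1, hx.2]
  filter_upwards [h] with q hq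
  simp only [clamp_of_mem hq]

variable {K : ℝ≥0} {L : ℝ} {ε Δ σ : ℝ}

theorem denoiserSqDist_lipschitz_le (hm : LipschitzWith K m) (hL : K + 1 ≤ L) (hΔ : 0 < Δ)
    (hσ : 0 < σ) (hD : IsOptimalLipschitzDenoiser L (dataLaw m Δ) σ D) :
    denoiserSqDist m σ D (limitDenoiser m (Real.toNNReal (σ ^ 2))) ≤
      2 * ENNReal.ofReal (averagingRate K L * Δ) := by
  set s := Real.toNNReal (σ ^ 2) with hs
  have hs0 : s ≠ 0 := toNNReal_sq_ne_zero hσ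
  have hmm := hm.continuous.measurable
  set r := ENNReal.ofReal (averagingRate K L * Δ)
  have hE : LipschitzDenoiser L (limitDenoiser m s) := lipschitzDenoiser_limitDenoiser hm hs0 hL
  have hE4 := denoisingLoss_dataLaw_le_four (Δ := Δ) (σ := σ) (abs_limitDenoiser_sub_le m hs0)
  have hE4' := denoisingLoss_meanLaw_le_four (σ := σ) (abs_limitDenoiser_sub_le m hs0)
  have hopt := hD.2 _ hE
  have h1 := (hD.1.denoisingLoss_close hm hΔ (hopt.trans hE4)).1
  have h2 := (hE.denoisingLoss_close hm hΔ hE4).2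
  have hmeas : Measurable (Function.uncurry fun u x => D u (clamp x)) := hD.1.continuous.measurable
  have h3 := denoisingLoss_meanLaw_eq_add hmm hσ hmeas
  rw [denoisingLoss_clamp, denoiserSqDist_clamp hmm] at h3
  rw [h3] at h1
  refine (ENNReal.add_le_add_iff_left (hE4'.trans_lt (by norm_num)).ne).1 ?_
  calc _ ≤ _ := h1
    _ ≤ _ := add_le_add_left (hopt.trans h2) r
    _ = _ := by rw [two_mul, add_assoc]

theorem denoiserSqDist_smoothed_le (hm : Measurable m) (hε : 0 < ε) (hΔ : 0 < Δ)
    (hΔε : 1 / (2 * ε) * Δ ≤ 1 / 2) (hσ : 0 < σ)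
    (hD : IsOptimalDenoiser (smoothedLaw m ε Δ) σ D) :
    denoiserSqDist m σ D (limitDenoiser m (Real.toNNReal (σ ^ 2))) ≤
      16 * ENNReal.ofReal (1 / (2 * ε) * Δ) := by
  set s := Real.toNNReal (σ ^ 2) with hs
  have hs0 : s ≠ 0 := toNNReal_sq_ne_zero hσ
  set a := 1 / (2 * ε) * Δ with ha
  have ha0 : 0 ≤ a := by positivity
  have hb := smoothedLaw_bounds m hε hΔ
  have hE4 := denoisingLoss_meanLaw_le_four (σ := σ) (abs_limitDenoiser_sub_le m hs0)
  have h1 := mul_denoisingLoss_le ENNReal.ofReal_ne_top (fun x _ => (hb x).1) σ D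
  have h2 := denoisingLoss_le_mul ENNReal.ofReal_ne_top (fun x _ => (hb x).2) σ
    (limitDenoiser m s)
  have hopt := hD.2 _ (measurable_limitDenoiser hm s)
  have h3 := denoisingLoss_meanLaw_eq_add hm hσ hD.1
  change _ * denoisingLoss (meanLaw m) σ D ≤ _ at h1
  change _ ≤ _ * denoisingLoss (meanLaw m) σ _ at h2
  rw [h3] at h1
  set J := denoisingLoss (meanLaw m) σ (limitDenoiser m s)
  set d := denoiserSqDist m σ D (limitDenoiser m s)
  have h4 := h1.trans (hopt.trans h2)
  rw [show 1 + a = (1 - a) + 2 * a by ring, ENNReal.ofReal_add (by linarith) (by linarith),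
    mul_add, add_mul] at h4
  have h5 := (ENNReal.add_le_add_iff_left
    (ENNReal.mul_ne_top ENNReal.ofReal_ne_top (hE4.trans_lt (by norm_num)).ne)).1 h4
  calc d = 2 * (ENNReal.ofReal (1 / 2) * d) := by
        rw [← mul_assoc, ← ENNReal.ofReal_ofNat 2, ← ENNReal.ofReal_mul (by norm_num)]
        norm_num
    _ ≤ 2 * (ENNReal.ofReal (1 - a) * d) := by
        gcongr
        linarith
    _ ≤ 2 * (ENNReal.ofReal (2 * a) * 4) := by
        gcongr 2 * ?_
        exact h5.trans (mul_le_mul' le_rfl hE4)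
    _ = _ := by
        rw [ENNReal.ofReal_mul (by norm_num), ENNReal.ofReal_ofNat]
        ring

/-- The two optimal denoisers are asymptotically equivalent, uniformly in the noise level. -/
theorem tendsto_iSup_denoiserSqDist (hm : LipschitzWith K m) (hL : K + 1 ≤ L) (hε : 0 < ε)
    {D Dt : ℝ → ℝ → ℝ → ℝ → ℝ}
    (h : ∀ Δ : ℝ, 0 < Δ → ∀ σ : ℝ, 0 < σ →
      IsOptimalLipschitzDenoiser L (dataLaw m Δ) σ (D Δ σ) ∧
      IsOptimalDenoiser (smoothedLaw m ε Δ) σ (Dt Δ σ)) :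
    Tendsto (fun Δ : ℝ => ⨆ σ : ℝ, ⨆ _ : 0 < σ, denoiserSqDist m σ (D Δ σ) (Dt Δ σ))
      (𝓝[>] 0) (𝓝 0) := by
  have hmm := hm.continuous.measurable
  set b : ℝ → ℝ≥0∞ := fun Δ => 2 * (2 * ENNReal.ofReal (averagingRate K L * Δ)) +
    2 * (16 * ENNReal.ofReal (1 / (2 * ε) * Δ)) with hb
  have hb0 : Tendsto b (𝓝[>] 0) (𝓝 0) := by
    have hc : Continuous b := by
      have h1 : Continuous fun Δ => ENNReal.ofReal (averagingRate K L * Δ) :=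
        ENNReal.continuous_ofReal.comp (by fun_prop)
      have h2 : Continuous fun Δ => ENNReal.ofReal (1 / (2 * ε) * Δ) :=
        ENNReal.continuous_ofReal.comp (by fun_prop)
      have h3 : ∀ c : ℝ≥0∞, c ≠ ∞ → Continuous fun y : ℝ≥0∞ => c * y := fun c hc =>
        ENNReal.continuous_const_mul hc
      exact ((h3 2 (by norm_num)).comp ((h3 2 (by norm_num)).comp h1)).add
        ((h3 2 (by norm_num)).comp ((h3 16 (by norm_num)).comp h2))
    have := hc.tendsto 0
    simp only [hb, mul_zero, ENNReal.ofReal_zero, add_zero] at this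
    exact this.mono_left nhdsWithin_le_nhds
  refine tendsto_of_tendsto_of_tendsto_of_le_of_le' tendsto_const_nhds hb0
    (.of_forall fun _ => zero_le) ?_
  filter_upwards [Ioo_mem_nhdsGT hε] with Δ hΔ
  refine iSup₂_le fun σ hσ => ?_
  obtain ⟨h1, h2⟩ := h Δ hΔ.1 σ hσ
  have hmeas : Measurable (Function.uncurry fun u x => D Δ σ u (clamp x)) :=
    h1.1.continuous.measurable
  have ht := denoiserSqDist_triangle (m := m) (D₃ := Dt Δ σ) σ hmeas
    (measurable_limitDenoiser hmm (Real.toNNReal (σ ^ 2)))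
  rw [denoiserSqDist_clamp hmm, denoiserSqDist_clamp hmm] at ht
  have hΔε : 1 / (2 * ε) * Δ ≤ 1 / 2 := by
    rw [one_div_mul_eq_div, div_le_iff₀ (by positivity)]
    linarith [hΔ.2]
  refine ht.trans ?_
  have g1 := denoiserSqDist_lipschitz_le hm hL hΔ.1 hσ h1
  have g2 := denoiserSqDist_smoothed_le hmm hε hΔ.1 hΔε hσ h2
  simp only [hb]
  gcongr

end

/-- A pointwise bounded equicontinuous sequence has a pointwise convergent subsequence. -/
theorem exists_subseq_tendsto_of_equicontinuous {X : Type*} [TopologicalSpace X]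
    [TopologicalSpace.SeparableSpace X] [Nonempty X] {f : ℕ → X → ℝ} {R : X → ℝ} {ω : X → X → ℝ}
    (hR : ∀ n p, |f n p| ≤ R p) (hω : ∀ n p p', |f n p - f n p'| ≤ ω p p')
    (hc : ∀ p, Continuous (ω p)) (h0 : ∀ p, ω p p = 0) :
    ∃ (φ : ℕ → ℕ) (g : X → ℝ), StrictMono φ ∧ ∀ p, Tendsto (fun n => f (φ n) p) atTop (𝓝 (g p)) := by
  set q := TopologicalSpace.denseSeq X
  have hK : IsCompact (Set.pi univ fun k => Icc (-R (q k)) (R (q k))) :=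
    isCompact_univ_pi fun k => isCompact_Icc
  obtain ⟨b, -, φ, hφ, hb⟩ := hK.tendsto_subseq (x := fun n k => f n (q k))
    fun n k _ => abs_le.1 (hR n (q k))
  rw [tendsto_pi_nhds] at hb
  have hcauchy : ∀ p, CauchySeq fun n => f (φ n) p := by
    intro p
    rw [Metric.cauchySeq_iff]
    intro e he
    have hopen : IsOpen {p' | ω p p' < e / 3} := isOpen_lt (hc p) continuous_const
    obtain ⟨_, hk, ⟨k, rfl⟩⟩ := (TopologicalSpace.denseRange_denseSeq X).inter_open_nonempty _ hopen
      ⟨p, by rw [mem_ofPred_eq, h0]; positivity⟩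
    obtain ⟨N, hN⟩ := Metric.cauchySeq_iff.1 (hb k).cauchySeq (e / 3) (by positivity)
    refine ⟨N, fun i hi j hj => ?_⟩
    have h1 := abs_lt.1 (by simpa [Real.dist_eq] using hN i hi j hj)
    have h2 := abs_le.1 (hω (φ i) p (q k))
    have h3 := abs_le.1 (hω (φ j) p (q k))
    have h4 : ω p (q k) < e / 3 := hk
    rw [Real.dist_eq, abs_lt]
    constructor <;> linarith [h1.1, h1.2, h2.1, h2.2, h3.1, h3.2]
  choose g hg using fun p => cauchySeq_tendsto_of_complete (hcauchy p)
  exact ⟨φ, g, hφ, hg⟩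

section

variable {m : ℝ → ℝ} {K : ℝ≥0} {L Δ σ : ℝ} {D : ℝ → ℝ → ℝ}

/-- A pointwise bound for the Lipschitz denoisers of small loss. -/
noncomputable def denoiserBound (m : ℝ → ℝ) (K : ℝ≥0) (L σ : ℝ) (p : ℝ × ℝ) : ℝ :=
  |m (clamp 0) + hat 0| + (2 * errorBound K L + 2 * L ^ 2 * (∫ η, η ^ 2 ∂(noise σ)) + 1) +
    L * (|p.1 - (m (clamp 0) + hat 0)| + |clamp p.2 - clamp 0|)

theorem LipschitzDenoiser.abs_le_denoiserBound (hD : LipschitzDenoiser L D)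
    (hm : LipschitzWith K m) (h4 : denoisingLoss (dataLaw m Δ) σ D ≤ 4) (p : ℝ × ℝ) :
    |D p.1 (clamp p.2)| ≤ denoiserBound m K L σ p := by
  set u := m (clamp 0) + hat 0 with hu
  have hB := hD.sqError_le_errorBound hm h4 0 0
  have hi := hD.integrable_sq σ u 0
  have hη : Integrable (fun η : ℝ => η ^ 2) (noise σ) := (memLp_id_noise σ).integrable_sq
  have h1 : (D u (clamp 0) - u) ^ 2 ≤ 2 * errorBound K L + 2 * L ^ 2 * ∫ η, η ^ 2 ∂(noise σ) := by
    calc (D u (clamp 0) - u) ^ 2 = ∫ _, (D u (clamp 0) - u) ^ 2 ∂(noise σ) := by simp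
      _ ≤ ∫ η, (2 * (D (u + η) (clamp 0) - u) ^ 2 + 2 * L ^ 2 * η ^ 2) ∂(noise σ) := by
          refine integral_mono (integrable_const _) ((hi.const_mul 2).add (hη.const_mul _))
            fun η => ?_
          have h := hD.abs_clamp_le (u + η) 0 u 0
          rw [add_sub_cancel_left, sub_self, abs_zero, add_zero] at h
          have h2 := pow_le_pow_left₀ (abs_nonneg _) h 2
          rw [mul_pow, sq_abs, sq_abs] at h2
          simp only
          nlinarith [sq_nonneg ((D (u + η) (clamp 0) - u) + (D (u + η) (clamp 0) - D u (clamp 0)))]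
      _ = 2 * sqError σ D u 0 + 2 * L ^ 2 * ∫ η, η ^ 2 ∂(noise σ) := by
          rw [integral_add (hi.const_mul 2) (hη.const_mul _), integral_const_mul,
            integral_const_mul, sqError]
      _ ≤ _ := by linarith
  have h2 : |D u (clamp 0) - u| ≤ (D u (clamp 0) - u) ^ 2 + 1 := by
    rw [abs_le]
    constructor <;> nlinarith [sq_nonneg (D u (clamp 0) - u - 1), sq_nonneg (D u (clamp 0) - u + 1),
      sq_nonneg (D u (clamp 0) - u)]
  have h3 := hD.abs_clamp_le p.1 p.2 u 0
  rw [denoiserBound, ← hu]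
  calc |D p.1 (clamp p.2)|
      = |u + (D u (clamp 0) - u) + (D p.1 (clamp p.2) - D u (clamp 0))| := by ring_nf
    _ ≤ |u| + |D u (clamp 0) - u| + |D p.1 (clamp p.2) - D u (clamp 0)| := abs_add_three _ _ _
    _ ≤ _ := by linarith

theorem measurable_toyMap (hm : Measurable m) (Δ : ℝ) : Measurable (toyMap m Δ) := by
  have := measurable_hat
  unfold toyMap
  fun_prop

/-- Lower semicontinuity of the loss under pointwise convergence. -/
theorem denoisingLoss_dataLaw_le_liminf (hm : Measurable m) (Δ σ : ℝ) {f : ℕ → ℝ → ℝ → ℝ}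
    (hf : ∀ n, Measurable (Function.uncurry (f n)))
    (h : ∀ u x, Tendsto (fun n => f n u x) atTop (𝓝 (D u x))) :
    denoisingLoss (dataLaw m Δ) σ D ≤
      liminf (fun n => denoisingLoss (dataLaw m Δ) σ (f n)) atTop := by
  have hS := measurable_toyMap hm Δ
  have hmeas : ∀ n, Measurable (Function.uncurry fun x η =>
      ENNReal.ofReal ((f n (toyMap m Δ x + η) x - toyMap m Δ x) ^ 2)) := fun n => by
    have : Measurable fun p : ℝ × ℝ => f n (toyMap m Δ p.1 + p.2) p.1 :=
      (hf n).comp (f := fun p : ℝ × ℝ => (toyMap m Δ p.1 + p.2, p.1)) (by fun_prop)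
    exact ((this.sub (hS.comp measurable_fst)).pow_const 2).ennreal_ofReal
  have hlim : ∀ x η, liminf (fun n =>
      ENNReal.ofReal ((f n (toyMap m Δ x + η) x - toyMap m Δ x) ^ 2)) atTop =
      ENNReal.ofReal ((D (toyMap m Δ x + η) x - toyMap m Δ x) ^ 2) := fun x η =>
    (ENNReal.tendsto_ofReal (((h _ x).sub_const _).pow 2)).liminf_eq
  simp only [denoisingLoss, dataLaw, lintegral_dirac]
  calc _ = ∫⁻ x, ∫⁻ η, liminf (fun n =>
          ENNReal.ofReal ((f n (toyMap m Δ x + η) x - toyMap m Δ x) ^ 2)) atTop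
          ∂(noise σ) ∂(uniformLaw 0 1) := by simp only [hlim]
    _ ≤ ∫⁻ x, liminf (fun n => ∫⁻ η,
          ENNReal.ofReal ((f n (toyMap m Δ x + η) x - toyMap m Δ x) ^ 2) ∂(noise σ)) atTop
          ∂(uniformLaw 0 1) := lintegral_mono fun x => lintegral_liminf_le fun n =>
            (hmeas n).comp (f := fun η => (x, η)) (by fun_prop)
    _ ≤ _ := lintegral_liminf_le fun n => Measurable.lintegral_prod_right' (hmeas n)

theorem exists_isOptimalLipschitzDenoiser (hm : LipschitzWith K m) (hL : K + 1 ≤ L) (Δ : ℝ)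
    (hσ : 0 < σ) : ∃ D : ℝ → ℝ → ℝ, IsOptimalLipschitzDenoiser L (dataLaw m Δ) σ D := by
  have hs0 := toNNReal_sq_ne_zero hσ
  set S : Set ℝ≥0∞ := {a | ∃ D, LipschitzDenoiser L D ∧ denoisingLoss (dataLaw m Δ) σ D = a ∧ a ≤ 4}
    with hS
  have hne : S.Nonempty := ⟨_, _, lipschitzDenoiser_limitDenoiser hm hs0 hL, rfl,
    denoisingLoss_dataLaw_le_four (abs_limitDenoiser_sub_le m hs0)⟩
  obtain ⟨a, -, ha, haS⟩ := exists_seq_tendsto_sInf hne (OrderBot.bddBelow S)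
  choose F hF hJ h4 using haS
  have hF4 : ∀ n, denoisingLoss (dataLaw m Δ) σ (F n) ≤ 4 := fun n => (hJ n).trans_le (h4 n)
  obtain ⟨φ, g, hφ, hg⟩ := exists_subseq_tendsto_of_equicontinuous
    (f := fun n (p : ℝ × ℝ) => F n p.1 (clamp p.2)) (R := denoiserBound m K L σ)
    (ω := fun p p' => L * (|p.1 - p'.1| + |clamp p.2 - clamp p'.2|))
    (fun n p => (hF n).abs_le_denoiserBound hm (hF4 n) p)
    (fun n p p' => (hF n).abs_clamp_le _ _ _ _)
    (fun p => by have := continuous_clamp; fun_prop) (fun p => by simp)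
  refine ⟨fun u x => g (u, x), fun u u' x hx x' hx' => ?_, fun D' hD' => ?_⟩
  · have h1 := hg (u, x)
    have h2 := hg (u', x')
    simp only [clamp_of_mem hx, clamp_of_mem hx'] at h1 h2
    exact le_of_tendsto' (h1.sub h2).abs fun n => hF (φ n) u u' x hx x' hx'
  · have hle : denoisingLoss (dataLaw m Δ) σ (fun u x => g (u, x)) ≤ sInf S := by
      refine (denoisingLoss_dataLaw_le_liminf hm.continuous.measurable Δ σ
        (f := fun n u x => F (φ n) u (clamp x)) (fun n => (hF (φ n)).continuous.measurable)
        fun u x => hg (u, x)).trans_eq ?_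
      simp only [denoisingLoss_clamp, hJ]
      exact (ha.comp hφ.tendsto_atTop).liminf_eq
    by_cases h : denoisingLoss (dataLaw m Δ) σ D' ≤ 4
    · exact hle.trans (sInf_le ⟨D', hD', rfl, h⟩)
    · obtain ⟨b, hb⟩ := hne
      obtain ⟨_, _, _, hb4⟩ := id hb
      exact hle.trans ((sInf_le hb).trans (hb4.trans (not_le.1 h).le))

end

theorem mainTheorem3 (K : ℝ≥0) :
    ∃ L₀ : ℝ, 0 < L₀ ∧ ∀ L : ℝ, L₀ ≤ L → ∀ m : ℝ → ℝ, LipschitzWith K m → ∀ ε : ℝ, 0 < ε →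
      -- the two optimal denoisers exist
      (∀ Δ : ℝ, 0 < Δ → ∀ σ : ℝ, 0 < σ →
        (∃ D : ℝ → ℝ → ℝ, IsOptimalLipschitzDenoiser L (dataLaw m Δ) σ D) ∧
        (∃ D : ℝ → ℝ → ℝ, IsOptimalDenoiser (smoothedLaw m ε Δ) σ D)) ∧
      -- they are asymptotically equivalent, uniformly in the noise level
      (∀ D Dt : ℝ → ℝ → ℝ → ℝ → ℝ,
        (∀ Δ : ℝ, 0 < Δ → ∀ σ : ℝ, 0 < σ →
          IsOptimalLipschitzDenoiser L (dataLaw m Δ) σ (D Δ σ) ∧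
          IsOptimalDenoiser (smoothedLaw m ε Δ) σ (Dt Δ σ)) →
        Tendsto (fun Δ : ℝ => ⨆ σ : ℝ, ⨆ _ : 0 < σ, denoiserSqDist m σ (D Δ σ) (Dt Δ σ))
          (𝓝[>] 0) (𝓝 0)) ∧
      -- the smoothed law tends to the uniform law
      (∃ C : ℝ, 0 < C ∧ ∀ Δ : ℝ, 0 < Δ → ∀ x ∈ Icc (0 : ℝ) 1,
        ENNReal.ofReal (1 - C * Δ) • uniformLaw (m x - 1) (m x + 1) ≤ smoothedLaw m ε Δ x ∧
        smoothedLaw m ε Δ x ≤ ENNReal.ofReal (1 + C * Δ) • uniformLaw (m x - 1) (m x + 1)) := by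
  refine ⟨K + 1, by positivity, fun L hL m hm ε hε => ⟨fun Δ hΔ σ hσ => ⟨?_, ?_⟩, ?_, ?_⟩⟩
  · exact exists_isOptimalLipschitzDenoiser hm hL Δ hσ
  · exact exists_isOptimalDenoiser_smoothedLaw hm.continuous.measurable hε Δ hσ
  · exact fun D Dt h => tendsto_iSup_denoiserSqDist hm hL hε h
  · exact ⟨1 / (2 * ε), by positivity, fun Δ hΔ x _ => smoothedLaw_bounds m hε hΔ x⟩
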